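/- Let $\mathcal H,\mathcal K$ be complex Hilbert spaces, with scalar products antilinear in the first argument. Let $T_0$ be an m-sectorial operator in $\mathcal H$ with vertex $\gamma\in\mathbb R$ and semi-angle $\theta\in[0,\pi/2)$, that is, $T_0+\alpha$ is m-accretive for some $\alpha\in\mathbb R$ and $(f,T_0f)\in\{\zeta : |\arg(\zeta-\gamma)|\le\theta\}$ for all unit vectors $f\in\operatorname{dom}(T_0)$. Let $\mathfrak q_{T_0}$ be the closed sectorial form associated with $T_0$. For a densely defined closed sectorial form $\mathfrak q$, the associated operator $S$ is given by: $v\in\operatorname{dom}(S)$ and $Sv=f$ if and only if $v\in\operatorname{dom}(\mathfrak q)$ and $\mathfrak q(w,v)=(w,f)_{\mathcal H}$ for all $w\in\operatorname{dom}(\mathfrak q)$. For an m-sectorial operator $S$ with vertex $\gamma$ put $\operatorname{dom}(S^{1/2}):=\operatorname{dom}((S+E)^{1/2})$ with any $E>-\gamma$ (the domain does not depend on $E$), where $(S+E)^{-1/2}=\frac1\pi\int_0^\infty\lambda^{-1/2}(S+E+\lambda)^{-1}\,d\lambda$. Assume: (i) $\operatorname{dom}(T_0^{1/2})=\operatorname{dom}((T_0^*)^{1/2})$.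 (ii) $A$ and $B$ are closed linear operators from $\mathcal H$ to $\mathcal K$ with $\operatorname{dom}(A)\supseteq\operatorname{dom}(T_0^{1/2})$ and $\operatorname{dom}(B)\supseteq\operatorname{dom}(T_0^{1/2})$, and for some $0\le a<1$, $b\ge 0$ and all $f\in\operatorname{dom}(T_0^{1/2})$, $$\|Af\|_{\mathcal K}^2\le a\operatorname{Re}\mathfrak q_{T_0}(f,f)+b\|f\|_{\mathcal H}^2,\qquad \|Bf\|_{\mathcal K}^2\le a\operatorname{Re}\mathfrak q_{T_0}(f,f)+b\|f\|_{\mathcal H}^2 .$$ (iii) $\lim_{E\uparrow\infty}\|K(-E)\|_{\mathcal B(\mathcal K)}=0$, where $K(z)=-\overline{A(T_0-z)^{-1}B^*}$ for $z\in\rho(T_0)$. Then the following hold. (a) $T_0$, $A$, $B$ are closed and densely defined, $\operatorname{dom}(T_0)\subseteq\operatorname{dom}(A)$, $\operatorname{dom}(T_0^*)\subseteq\operatorname{dom}(B)$, $K(z)\in\mathcal B(\mathcal K)$ for all $z\in\rho(T_0)$, and $1\in\rho(K(z_0))$ for some $z_0\in\rho(T_0)$. (b) $\operatorname{dom}(\mathfrak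 q_{T_0})=\operatorname{dom}(T_0^{1/2})$, and the form $$\mathfrak q(f,g)=\mathfrak q_{T_0}(f,g)+(Bf,Ag)_{\mathcal K},\qquad f,g\in\operatorname{dom}(T_0^{1/2}),$$ is closed and sectorial; the associated operator, denoted $T_0+_{\mathfrak q}W$ (the form sum of $T_0$ and $W=B^*A$), is m-sectorial. (c) There is exactly one operator $T$ in $\mathcal H$ such that $$(T-z)^{-1}=(T_0-z)^{-1}-\overline{(T_0-z)^{-1}B^*}\,[I_{\mathcal K}-K(z)]^{-1}A(T_0-z)^{-1}$$ for all $z\in\rho(T_0)$ with $1\in\rho(K(z))$, and it is the form sum: $T=T_0+_{\mathfrak q}W$. -/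

import Mathlib

open Filter Topology MeasureTheory
open scoped InnerProductSpace LinearPMap

noncomputable section

namespace Kato

variable {H F G : Type*}
variable [NormedAddCommGroup H] [InnerProductSpace ℂ H]
variable [NormedAddCommGroup F] [InnerProductSpace ℂ F]
variable [NormedAddCommGroup G] [InnerProductSpace ℂ G]

/-! ### Resolvents of unbounded operators -/

/-- `R` is a bounded, everywhere defined, two-sided inverse of `T - z`. -/
def IsResolventAt (T : H →ₗ.[ℂ] H) (z : ℂ) (R : H →L[ℂ] H) : Prop :=
  (∀ f : H, ∃ h : R f ∈ T.domain, T ⟨R f, h⟩ - z • R f = f) ∧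
    ∀ u : T.domain, R (T u - z • (u : H)) = u

/-- The resolvent set `ρ(T)`. -/
def rho (T : H →ₗ.[ℂ] H) : Set ℂ := {z | ∃ R : H →L[ℂ] H, IsResolventAt T z R}

open Classical in
/-- The resolvent `(T - z)⁻¹` for `z ∈ ρ(T)` (it is unique), and `0` for `z ∉ ρ(T)`. -/
def resolv (T : H →ₗ.[ℂ] H) (z : ℂ) : H →L[ℂ] H :=
  if h : ∃ R : H →L[ℂ] H, IsResolventAt T z R then h.choose else 0

/-! ### Accretive and sectorial operators -/

/-- The operator `T + c` with domain `dom T`. -/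
def shift (T : H →ₗ.[ℂ] H) (c : ℂ) : H →ₗ.[ℂ] H where
  domain := T.domain
  toFun := T.toFun + c • T.domain.subtype

/-- `D` is m-accretive: `(D + ζ)⁻¹` is bounded and everywhere defined with norm at most
`1 / Re ζ` whenever `Re ζ > 0`. -/
def IsMAccretive (D : H →ₗ.[ℂ] H) : Prop :=
  ∀ ζ : ℂ, 0 < ζ.re → -ζ ∈ rho D ∧ ‖resolv D (-ζ)‖ ≤ (ζ.re)⁻¹

/-- The closed sector with vertex `γ` and semi-angle `θ`, symmetric about `[γ, ∞)`. -/
def sector (γ θ : ℝ) : Set ℂ := {ζ | |(ζ - (γ : ℂ)).arg| ≤ θ}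

/-- The numerical range of an operator. -/
def numRange (D : H →ₗ.[ℂ] H) : Set ℂ :=
  {ζ | ∃ f : D.domain, ‖(f : H)‖ = 1 ∧ ζ = ⟪(f : H), D f⟫_ℂ}

/-- `D` is m-sectorial with vertex `γ` and semi-angle `θ ∈ [0, π/2)`: it is quasi-m-accretive (hence
closed and densely defined) and its numerical range lies in the corresponding sector. -/
structure IsMSectorial (D : H →ₗ.[ℂ] H) (γ θ : ℝ) : Prop where
  angle_nonneg : 0 ≤ θ
  angle_lt : θ < Real.pi / 2
  quasi : ∃ α : ℝ, IsMAccretive (shift D (α : ℂ))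
  range_subset : numRange D ⊆ sector γ θ

/-! ### Square roots -/

/-- `(T + E)^(-1/2) = π⁻¹ ∫₀^∞ λ^(-1/2) (T + E + λ)⁻¹ dλ`, a norm convergent integral whenever
`T + E` is m-accretive with a strictly positive lower bound. -/
def invSqrt (T : H →ₗ.[ℂ] H) (E : ℝ) : H →L[ℂ] H :=
  (Real.pi)⁻¹ • ∫ l in Set.Ioi (0 : ℝ), (l ^ (-(1 / 2) : ℝ)) • resolv T (-((E + l : ℝ) : ℂ))

/-- `(T + E)^(1/2)`, the (unbounded) inverse of `(T + E)^(-1/2)`. -/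
def shiftSqrt (T : H →ₗ.[ℂ] H) (E : ℝ) : H →ₗ.[ℂ] H :=
  ((invSqrt T E : H →ₗ[ℂ] H).toPMap ⊤).inverse

/-- `dom ((T + E)^(1/2))`. For m-sectorial `T` with vertex `γ` it is the same subspace for all
`E > -γ`, and it is `dom (T^(1/2))`. -/
def sqrtDomain (T : H →ₗ.[ℂ] H) (E : ℝ) : Submodule ℂ H := (shiftSqrt T E).domain

/-! ### Sesquilinear forms -/

variable (H) in
/-- A sesquilinear form, antilinear in the first and linear in the second argument, on a subspace
of `H`. -/
structure SesqForm where
  /-- The form domain. -/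
  domain : Submodule ℂ H
  /-- The form itself. -/
  form : domain →ₗ⋆[ℂ] domain →ₗ[ℂ] ℂ

namespace SesqForm

/-- The values `q(u, u)` on unit vectors. -/
def numRange (q : SesqForm H) : Set ℂ :=
  {ζ | ∃ u : q.domain, ‖(u : H)‖ = 1 ∧ ζ = q.form u u}

/-- The square of the form norm belonging to the vertex `c`: `Re q(u, u) + (1 - c) ‖u‖²`. -/
def normSq (q : SesqForm H) (c : ℝ) (u : q.domain) : ℝ :=
  (q.form u u).re + (1 - c) * ‖(u : H)‖ ^ 2

/-- The form domain is complete in the form norm. -/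
def IsComplete (q : SesqForm H) (c : ℝ) : Prop :=
  ∀ s : ℕ → q.domain,
    Tendsto (fun p : ℕ × ℕ => q.normSq c (s p.1 - s p.2)) atTop (𝓝 0) →
      ∃ u : q.domain, Tendsto (fun n => q.normSq c (s n - u)) atTop (𝓝 0)

/-- The form `q` is sectorial and closed. -/
def IsClosedSectorial (q : SesqForm H) : Prop :=
  ∃ c θ : ℝ, 0 ≤ θ ∧ θ < Real.pi / 2 ∧ q.numRange ⊆ sector c θ ∧ q.IsComplete c

/-- The graph of the operator associated with `q`: all `(v, f)` with `v` in the form domain and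
`q(w, v) = ⟪w, f⟫` for all `w` in the form domain. -/
def opGraph (q : SesqForm H) : Submodule ℂ (H × H) where
  carrier := {p | ∃ h : p.1 ∈ q.domain, ∀ w : q.domain, q.form w ⟨p.1, h⟩ = ⟪(w : H), p.2⟫_ℂ}
  add_mem' := by
    rintro ⟨v, f⟩ ⟨v', f'⟩ ⟨h, hf⟩ ⟨h', hf'⟩
    refine ⟨q.domain.add_mem h h', fun w => ?_⟩
    have := (q.form w).map_add ⟨v, h⟩ ⟨v', h'⟩
    simp only [Prod.fst_add, Prod.snd_add, inner_add_right]
    rw [← hf w, ← hf' w, ← this]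
    rfl
  zero_mem' := ⟨q.domain.zero_mem, fun w => by
    refine ((q.form w).map_zero).trans ?_
    simp⟩
  smul_mem' := by
    rintro c ⟨v, f⟩ ⟨h, hf⟩
    refine ⟨q.domain.smul_mem c h, fun w => ?_⟩
    have := (q.form w).map_smul c ⟨v, h⟩
    simp only [Prod.smul_fst, Prod.smul_snd, inner_smul_right]
    rw [← hf w, ← smul_eq_mul, ← this]
    rfl

/-- The operator associated with a densely defined form `q`. -/
def operator (q : SesqForm H) : H →ₗ.[ℂ] H := q.opGraph.toLinearPMap

/-- The sum of two forms, on the intersection of their domains. -/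
def add (p q : SesqForm H) : SesqForm H where
  domain := p.domain ⊓ q.domain
  form := LinearMap.mk₂'ₛₗ (starRingEnd ℂ) (RingHom.id ℂ)
    (fun u v => p.form ⟨u, u.2.1⟩ ⟨v, v.2.1⟩ + q.form ⟨u, u.2.2⟩ ⟨v, v.2.2⟩)
    (fun u u' v => by
      have h1 := congrArg (fun φ => φ (⟨v, v.2.1⟩ : p.domain))
        (p.form.map_add ⟨u, u.2.1⟩ ⟨u', u'.2.1⟩)
      have h2 := congrArg (fun φ => φ (⟨v, v.2.2⟩ : q.domain))
        (q.form.map_add ⟨u, u.2.2⟩ ⟨u', u'.2.2⟩)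
      refine (congrArg₂ (· + ·) h1 h2).trans ?_
      simp only [LinearMap.add_apply]
      ring)
    (fun c u v => by
      have h1 := congrArg (fun φ => φ (⟨v, v.2.1⟩ : p.domain))
        (p.form.map_smulₛₗ c ⟨u, u.2.1⟩)
      have h2 := congrArg (fun φ => φ (⟨v, v.2.2⟩ : q.domain))
        (q.form.map_smulₛₗ c ⟨u, u.2.2⟩)
      refine (congrArg₂ (· + ·) h1 h2).trans ?_
      simp only [LinearMap.smul_apply, smul_add])
    (fun u v v' => by
      have h1 := (p.form ⟨u, u.2.1⟩).map_add ⟨v, v.2.1⟩ ⟨v', v'.2.1⟩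
      have h2 := (q.form ⟨u, u.2.2⟩).map_add ⟨v, v.2.2⟩ ⟨v', v'.2.2⟩
      refine (congrArg₂ (· + ·) h1 h2).trans ?_
      ring)
    (fun c u v => by
      have h1 := (p.form ⟨u, u.2.1⟩).map_smul c ⟨v, v.2.1⟩
      have h2 := (q.form ⟨u, u.2.2⟩).map_smul c ⟨v, v.2.2⟩
      refine (congrArg₂ (· + ·) h1 h2).trans ?_
      simp only [RingHom.id_apply, smul_add])

end SesqForm

open Classical in
/-- The form `q_T` of an m-sectorial operator `T`: the unique closed sectorial form whose associated
operator is `T`. (If there is no such form: the zero form.) -/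
def formOf (T : H →ₗ.[ℂ] H) : SesqForm H :=
  if h : ∃ q : SesqForm H, q.IsClosedSectorial ∧ q.operator = T then h.choose else ⟨⊤, 0⟩

/-- The form `q_W(f, g) = ⟪B f, A g⟫` on `dom A ∩ dom B`, formally the form of `W = B* A`. -/
def formW (A B : H →ₗ.[ℂ] F) : SesqForm H where
  domain := A.domain ⊓ B.domain
  form := LinearMap.mk₂'ₛₗ (starRingEnd ℂ) (RingHom.id ℂ)
    (fun f g => ⟪B ⟨f, f.2.2⟩, A ⟨g, g.2.1⟩⟫_ℂ)
    (fun f f' g => by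
      have h := B.map_add ⟨f, f.2.2⟩ ⟨f', f'.2.2⟩
      rw [← inner_add_left, ← h]
      rfl)
    (fun c f g => by
      have h := B.map_smul c ⟨f, f.2.2⟩
      rw [smul_eq_mul, ← inner_smul_left, ← h]
      rfl)
    (fun f g g' => by
      have h := A.map_add ⟨g, g.2.1⟩ ⟨g', g'.2.1⟩
      rw [← inner_add_right, ← h]
      rfl)
    (fun c f g => by
      have h := A.map_smul c ⟨g, g.2.1⟩
      rw [RingHom.id_apply, smul_eq_mul, ← inner_smul_right, ← h]
      rfl)

/-- The form `q_{T₀} + q_W`. -/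
def sumForm (T₀ : H →ₗ.[ℂ] H) (A B : H →ₗ.[ℂ] F) : SesqForm H := (formOf T₀).add (formW A B)

/-- The form sum of `T₀` and `W = B* A`: the operator associated with `q_{T₀} + q_W`. -/
def formSum (T₀ : H →ₗ.[ℂ] H) (A B : H →ₗ.[ℂ] F) : H →ₗ.[ℂ] H := (sumForm T₀ A B).operator

/-! ### Kato's resolvent formula -/

/-- The product `A S` on its natural domain `{x ∈ dom S | S x ∈ dom A}`. -/
def comp (A : F →ₗ.[ℂ] G) (S : H →ₗ.[ℂ] F) : H →ₗ.[ℂ] G where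
  domain :=
    { carrier := {x | ∃ h : x ∈ S.domain, S ⟨x, h⟩ ∈ A.domain}
      add_mem' := by
        rintro x y ⟨hx, hx'⟩ ⟨hy, hy'⟩
        refine ⟨S.domain.add_mem hx hy, ?_⟩
        have h := S.map_add ⟨x, hx⟩ ⟨y, hy⟩
        have h' := A.domain.add_mem hx' hy'
        rw [← h] at h'
        exact h'
      zero_mem' := ⟨S.domain.zero_mem, by
        have h := S.map_zero
        have h' := A.domain.zero_mem
        rw [← h] at h'
        exact h'⟩
      smul_mem' := by
        rintro c x ⟨hx, hx'⟩
        refine ⟨S.domain.smul_mem c hx, ?_⟩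
        have h := S.map_smul c ⟨x, hx⟩
        have h' := A.domain.smul_mem c hx'
        rw [← h] at h'
        exact h' }
  toFun :=
    { toFun := fun x => A ⟨S ⟨x, x.2.choose⟩, x.2.choose_spec⟩
      map_add' := by
        intro x y
        rw [← A.map_add]
        congr 1
        exact Subtype.ext (S.map_add ⟨x, x.2.choose⟩ ⟨y, y.2.choose⟩)
      map_smul' := by
        intro c x
        rw [RingHom.id_apply, ← A.map_smul]
        congr 1
        exact Subtype.ext (S.map_smul c ⟨x, x.2.choose⟩) }

/-- `C` is the closure of `S`, where `S` is densely defined and `C` is bounded. -/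
def IsBoundedClosure (S : F →ₗ.[ℂ] G) (C : F →L[ℂ] G) : Prop :=
  Dense (S.domain : Set F) ∧ ∀ x : S.domain, C x = S x

open Classical in
/-- The closure of a densely defined bounded operator, as an everywhere defined bounded operator
(and `0` if `S` is not of that kind). -/
def bddClosure (S : F →ₗ.[ℂ] G) : F →L[ℂ] G :=
  if h : ∃ C : F →L[ℂ] G, IsBoundedClosure S C then h.choose else 0

/-- `A (T₀ - z)⁻¹`. -/
def resA (T₀ : H →ₗ.[ℂ] H) (A : H →ₗ.[ℂ] F) (z : ℂ) : H →ₗ.[ℂ] F :=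
  comp A ((resolv T₀ z : H →ₗ[ℂ] H).toPMap ⊤)

variable [CompleteSpace H]

/-- `(T₀ - z)⁻¹ B*`, defined on `dom (B*)`. -/
def resB (T₀ : H →ₗ.[ℂ] H) (B : H →ₗ.[ℂ] F) (z : ℂ) : F →ₗ.[ℂ] H :=
  (resolv T₀ z : H →ₗ[ℂ] H).compPMap B†

/-- `-A (T₀ - z)⁻¹ B*`, defined on its natural domain. -/
def preK (T₀ : H →ₗ.[ℂ] H) (A B : H →ₗ.[ℂ] F) (z : ℂ) : F →ₗ.[ℂ] F :=
  -comp A (resB T₀ B z)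

/-- `K(z)`, the closure of `-A (T₀ - z)⁻¹ B*`. -/
def opK (T₀ : H →ₗ.[ℂ] H) (A B : H →ₗ.[ℂ] F) (z : ℂ) : F →L[ℂ] F :=
  bddClosure (preK T₀ A B z)

/-- The set of all `z ∈ ρ(T₀)` such that `1 ∈ ρ(K(z))`. -/
def katoSet (T₀ : H →ₗ.[ℂ] H) (A B : H →ₗ.[ℂ] F) : Set ℂ :=
  {z | z ∈ rho T₀ ∧ (1 : ℂ) ∈ resolventSet ℂ (opK T₀ A B z)}

/-- `R(z) = (T₀ - z)⁻¹ - closure((T₀ - z)⁻¹ B*) (1 - K(z))⁻¹ A (T₀ - z)⁻¹`. -/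
def katoR (T₀ : H →ₗ.[ℂ] H) (A B : H →ₗ.[ℂ] F) (z : ℂ) : H →L[ℂ] H :=
  resolv T₀ z -
    (bddClosure (resB T₀ B z)).comp
      ((Ring.inverse (1 - opK T₀ A B z)).comp (bddClosure (resA T₀ A z)))

/-- The conditions under which Kato's formula makes sense and defines an operator. -/
structure KatoAdmissible (T₀ : H →ₗ.[ℂ] H) (A B : H →ₗ.[ℂ] F) : Prop where
  dense_T₀ : Dense (T₀.domain : Set H)
  closed_T₀ : T₀.IsClosed
  dense_A : Dense (A.domain : Set H)
  closed_A : A.IsClosed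
  dense_B : Dense (B.domain : Set H)
  closed_B : B.IsClosed
  dom_A : T₀.domain ≤ A.domain
  dom_B : T₀†.domain ≤ B.domain
  bounded_K : ∀ z ∈ rho T₀, ∃ C : F →L[ℂ] F, IsBoundedClosure (preK T₀ A B z) C
  nonempty : (katoSet T₀ A B).Nonempty

/-- `T` is the operator defined by Kato's formula: `(T - z)⁻¹ = R(z)` for all `z ∈ ρ(T₀)` such that
`1 ∈ ρ(K(z))`. -/
def IsKatoSum (T₀ : H →ₗ.[ℂ] H) (A B : H →ₗ.[ℂ] F) (T : H →ₗ.[ℂ] H) : Prop :=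
  ∀ z ∈ katoSet T₀ A B, IsResolventAt T z (katoR T₀ A B z)

end Kato

end

/-! A closed sectorial form is a bounded coercive operator in disguise. Under the form norm its
domain becomes a Hilbert space `V` with a bounded injection `p : V → H`, and the form reads `⟪x, N
y⟫` with `N` bounded on `V` (`FormRep`). The associated operator is `p†⁻¹ N p⁻¹`, so its resolvent
is `p (N - z p† p)⁻¹ p†`. Lax-Milgram inverts `N - z p† p` far to the left, and
`FormRep.exists_inverse_of_mem_rho` carries this to every `z` in the resolvent set.

In this picture the theorem is algebra. The relative bounds make `α = A p` and `β = B p` bounded,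
and the form sum is represented by `N + β† α`, still coercive because `a < 1`. With `L = (N - z p†
p)⁻¹` the unbounded products close up to `α L p†`, `p L β†` and `K(z) = -α L β†`. Kato's formula is
then the Woodbury identity for `(N - z p† p + β† α)⁻¹` placed between `p` and `p†` (`woodbury`,
`isResolventAt_katoR`). Decay of `K(-E)` supplies a point where the formula applies, and one
resolvent determines its operator.

Two inputs remain. Every m-sectorial operator comes from a closed form: factor `(T + E)⁻¹ = p M p`
with `p` the square root of its real part and `Re M = 1` (`exists_factorization`,
`IsMSectorial.exists_form`). The form domain is the square root domain under assumption (i): the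
integral `J` squares to the resolvent (`IsPseudoResolvent.sqrtIntegral_mul_self`), and equality of
the ranges of `J` and `J†` forces both to be the range of `p` (`range_eq_of_sqrt`). -/

noncomputable section

namespace Kato

/-! ### Square roots of pseudo-resolvents in Banach algebras -/

section PseudoResolvent

variable {𝒜 : Type*} [NormedRing 𝒜] [NormedAlgebra ℝ 𝒜]

/-- A pseudo-resolvent on the open half-line with the bound of an accretive operator. -/
structure IsPseudoResolvent (r : ℝ → 𝒜) : Prop where
  norm_le : ∀ x, 0 < x → ‖r x‖ ≤ x⁻¹
  identity : ∀ x y, 0 < x → 0 < y → r x - r y = (y - x) • (r x * r y)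

theorem hasDerivAt_arctan_sqrt {E l : ℝ} (hE : 0 < E) (hl : 0 < l) :
    HasDerivAt (fun l => 2 / √E * Real.arctan (√l / √E)) (l ^ (-(1 / 2) : ℝ) * (E + l)⁻¹) l := by
  have h1 : HasDerivAt (fun l => √l / √E) (1 / (2 * √l) / √E) l :=
    (Real.hasDerivAt_sqrt hl.ne').div_const _
  have h2 := (h1.arctan).const_mul (2 / √E)
  refine h2.congr_deriv ?_
  have hE' := Real.sqrt_pos.2 hE
  have hl' := Real.sqrt_pos.2 hl
  rw [Real.rpow_neg hl.le, ← Real.sqrt_eq_rpow, div_pow, Real.sq_sqrt hE.le, Real.sq_sqrt hl.le]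
  have : (√E) ^ 2 = E := Real.sq_sqrt hE.le
  field_simp
  rw [this]

theorem tendsto_arctan_sqrt {E : ℝ} (hE : 0 < E) :
    Tendsto (fun l => 2 / √E * Real.arctan (√l / √E)) atTop (𝓝 (Real.pi / √E)) := by
  have h : Tendsto (fun l => √l / √E) atTop atTop :=
    Real.tendsto_sqrt_atTop.atTop_div_const (Real.sqrt_pos.2 hE)
  have h2 := ((tendsto_nhds_of_tendsto_nhdsWithin Real.tendsto_arctan_atTop).comp h).const_mul
    (2 / √E)
  rw [show Real.pi / √E = 2 / √E * (Real.pi / 2) by ring]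
  exact h2

theorem continuousWithinAt_arctan_sqrt (E : ℝ) :
    ContinuousWithinAt (fun l => 2 / √E * Real.arctan (√l / √E)) (Set.Ici 0) 0 := by
  apply Continuous.continuousWithinAt
  fun_prop

theorem integrableOn_rpow_mul_inv {E : ℝ} (hE : 0 < E) :
    IntegrableOn (fun l : ℝ => l ^ (-(1 / 2) : ℝ) * (E + l)⁻¹) (Set.Ioi 0) :=
  integrableOn_Ioi_deriv_of_nonneg (continuousWithinAt_arctan_sqrt E)
    (fun _ hl => hasDerivAt_arctan_sqrt hE hl)
    (fun l (hl : 0 < l) => by positivity) (tendsto_arctan_sqrt hE)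

theorem integral_rpow_mul_inv {E : ℝ} (hE : 0 < E) :
    ∫ l in Set.Ioi (0 : ℝ), l ^ (-(1 / 2) : ℝ) * (E + l)⁻¹ = Real.pi / √E := by
  rw [integral_Ioi_of_hasDerivAt_of_nonneg (continuousWithinAt_arctan_sqrt E)
    (fun _ hl => hasDerivAt_arctan_sqrt hE hl)
    (fun l (hl : 0 < l) => by positivity) (tendsto_arctan_sqrt hE)]
  simp

/-- `∫₀^∞ l^(-1/2) r(E + l) dl`. -/
def sqrtIntegral (r : ℝ → 𝒜) (E : ℝ) : 𝒜 :=
  ∫ l in Set.Ioi (0 : ℝ), (l ^ (-(1 / 2) : ℝ)) • r (E + l)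

namespace IsPseudoResolvent

variable {r : ℝ → 𝒜} (hr : IsPseudoResolvent r)

include hr

theorem mul_comm {x y : ℝ} (hx : 0 < x) (hy : 0 < y) : r x * r y = r y * r x := by
  rcases eq_or_ne x y with rfl | hxy
  · rfl
  have h1 := hr.identity x y hx hy
  have h2 := hr.identity y x hy hx
  have h3 : (y - x) • (r x * r y) = (y - x) • (r y * r x) := by
    rw [← h1, ← neg_sub (r y), h2, ← neg_smul, neg_sub]
  exact smul_right_injective _ (sub_ne_zero.2 hxy.symm) h3

theorem continuousOn : ContinuousOn r (Set.Ioi 0) := by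
  intro x hx
  apply ContinuousAt.continuousWithinAt
  have hx : 0 < x := hx
  rw [ContinuousAt, tendsto_iff_norm_sub_tendsto_zero]
  have h0 : Tendsto (fun y : ℝ => |x - y| * (y⁻¹ * x⁻¹)) (𝓝 x) (𝓝 0) := by
    have : ContinuousAt (fun y : ℝ => |x - y| * (y⁻¹ * x⁻¹)) x := by
      have := hx.ne'
      fun_prop (disch := assumption)
    simpa using this.tendsto
  refine squeeze_zero' (Eventually.of_forall fun _ => norm_nonneg _) ?_ h0
  filter_upwards [lt_mem_nhds hx] with y hy
  rw [hr.identity y x hy hx, norm_smul, Real.norm_eq_abs]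
  gcongr
  exact (norm_mul_le _ _).trans (mul_le_mul (hr.norm_le _ hy) (hr.norm_le _ hx) (norm_nonneg _)
    (inv_nonneg.2 hy.le))

theorem hasDerivAt {x : ℝ} (hx : 0 < x) : HasDerivAt r (-(r x * r x)) x := by
  rw [hasDerivAt_iff_tendsto_slope]
  have hc : ContinuousAt r x := hr.continuousOn.continuousAt (Ioi_mem_nhds hx)
  have h1 : Tendsto (fun y => -(r y * r x)) (𝓝[≠] x) (𝓝 (-(r x * r x))) :=
    ((hc.tendsto.mul_const _).neg).mono_left nhdsWithin_le_nhds
  refine h1.congr' ?_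
  filter_upwards [self_mem_nhdsWithin, nhdsWithin_le_nhds (lt_mem_nhds hx)] with y hy hy0
  have hy : y ≠ x := hy
  rw [slope_def_module, hr.identity y x hy0 hx, smul_smul, ← neg_sub y x, mul_neg,
    inv_mul_cancel₀ (sub_ne_zero.2 hy), neg_one_smul]

theorem hasDerivAt_add {E l : ℝ} (h : 0 < E + l) :
    HasDerivAt (fun l => r (E + l)) (-(r (E + l) * r (E + l))) l := by
  have := (hr.hasDerivAt h).comp_const_add E l
  exact this

theorem continuousOn_integrand {E : ℝ} (hE : 0 < E) :
    ContinuousOn (fun l : ℝ => (l ^ (-(1 / 2) : ℝ)) • r (E + l)) (Set.Ioi 0) := by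
  refine ContinuousOn.smul ?_ ?_
  · exact fun l hl => (Real.continuousAt_rpow_const _ _ (Or.inl (ne_of_gt hl))).continuousWithinAt
  · exact hr.continuousOn.comp (by fun_prop) fun l (hl : 0 < l) => add_pos hE hl

theorem norm_integrand_le {E l : ℝ} (hE : 0 < E) (hl : 0 < l) :
    ‖(l ^ (-(1 / 2) : ℝ)) • r (E + l)‖ ≤ l ^ (-(1 / 2) : ℝ) * (E + l)⁻¹ := by
  rw [norm_smul, Real.norm_of_nonneg (by positivity)]
  gcongr
  exact hr.norm_le _ (by positivity)

theorem integrableOn {E : ℝ} (hE : 0 < E) :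
    IntegrableOn (fun l : ℝ => (l ^ (-(1 / 2) : ℝ)) • r (E + l)) (Set.Ioi 0) := by
  refine (integrableOn_rpow_mul_inv hE).mono'
    ((hr.continuousOn_integrand hE).aestronglyMeasurable measurableSet_Ioi) ?_
  filter_upwards [ae_restrict_mem measurableSet_Ioi] with l hl
  exact hr.norm_integrand_le hE hl

theorem continuousOn_integrand_sq {E : ℝ} (hE : 0 < E) :
    ContinuousOn (fun l : ℝ => (l ^ (-(1 / 2) : ℝ)) • (r (E + l) * r (E + l))) (Set.Ioi 0) := by
  have h : ContinuousOn (fun l : ℝ => r (E + l)) (Set.Ioi 0) :=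
    hr.continuousOn.comp (by fun_prop) fun l (hl : 0 < l) => add_pos hE hl
  exact ContinuousOn.smul
    (fun l hl => (Real.continuousAt_rpow_const _ _ (Or.inl (ne_of_gt hl))).continuousWithinAt)
    (h.mul h)

/-- The bound is uniform in `E ≥ d`, as needed to differentiate under the integral sign. -/
theorem norm_integrand_sq_le {d E l : ℝ} (hd : 0 < d) (hE : d ≤ E) (hl : 0 < l) :
    ‖(l ^ (-(1 / 2) : ℝ)) • (r (E + l) * r (E + l))‖ ≤
      l ^ (-(1 / 2) : ℝ) * (d + l)⁻¹ * d⁻¹ := by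
  rw [norm_smul, Real.norm_of_nonneg (by positivity), mul_assoc]
  have h1 : ‖r (E + l)‖ ≤ (d + l)⁻¹ :=
    (hr.norm_le _ (by linarith)).trans (inv_anti₀ (by positivity) (by linarith))
  have h2 : ‖r (E + l)‖ ≤ d⁻¹ := h1.trans (inv_anti₀ hd (by linarith))
  gcongr
  exact (norm_mul_le _ _).trans (mul_le_mul h1 h2 (norm_nonneg _) (by positivity))

theorem integrableOn_sq {E : ℝ} (hE : 0 < E) :
    IntegrableOn (fun l : ℝ => (l ^ (-(1 / 2) : ℝ)) • (r (E + l) * r (E + l))) (Set.Ioi 0) := by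
  refine ((integrableOn_rpow_mul_inv hE).mul_const E⁻¹).mono'
    ((hr.continuousOn_integrand_sq hE).aestronglyMeasurable measurableSet_Ioi) ?_
  filter_upwards [ae_restrict_mem measurableSet_Ioi] with l hl
  exact hr.norm_integrand_sq_le hE le_rfl hl

theorem norm_sqrtIntegral_le {E : ℝ} (hE : 0 < E) : ‖sqrtIntegral r E‖ ≤ Real.pi / √E := by
  rw [← integral_rpow_mul_inv hE]
  refine norm_integral_le_of_norm_le (integrableOn_rpow_mul_inv hE) ?_
  filter_upwards [ae_restrict_mem measurableSet_Ioi] with l hl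
  exact hr.norm_integrand_le hE hl

variable [CompleteSpace 𝒜]

theorem mul_sqrtIntegral {e E : ℝ} (hE : 0 < E) :
    r e * sqrtIntegral r E = ∫ l in Set.Ioi (0 : ℝ), (l ^ (-(1 / 2) : ℝ)) • (r e * r (E + l)) := by
  have := (ContinuousLinearMap.mul ℝ 𝒜 (r e)).integral_comp_comm (hr.integrableOn hE)
  simpa [sqrtIntegral] using this.symm

theorem sqrtIntegral_mul {e E : ℝ} (hE : 0 < E) :
    sqrtIntegral r E * r e = ∫ l in Set.Ioi (0 : ℝ), (l ^ (-(1 / 2) : ℝ)) • (r (E + l) * r e) := by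
  have := ((ContinuousLinearMap.mul ℝ 𝒜).flip (r e)).integral_comp_comm (hr.integrableOn hE)
  simpa [sqrtIntegral] using this.symm

theorem sqrtIntegral_comm {e E : ℝ} (he : 0 < e) (hE : 0 < E) :
    sqrtIntegral r E * r e = r e * sqrtIntegral r E := by
  rw [hr.mul_sqrtIntegral hE, hr.sqrtIntegral_mul hE]
  refine setIntegral_congr_fun measurableSet_Ioi fun l (hl : 0 < l) => ?_
  simp only [hr.mul_comm he (add_pos hE hl)]

/-- Integration by parts: the resolvent identity makes the difference of the two integrands the
derivative of `2 √l r(E) r(E + l)`, which vanishes at `0` and at infinity. -/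
theorem integral_sq {E : ℝ} (hE : 0 < E) :
    (2 : ℝ) • ∫ l in Set.Ioi (0 : ℝ), (l ^ (-(1 / 2) : ℝ)) • (r (E + l) * r (E + l)) =
      r E * sqrtIntegral r E := by
  have hint1 : IntegrableOn (fun l : ℝ => (l ^ (-(1 / 2) : ℝ)) • (r E * r (E + l)))
      (Set.Ioi 0) := by
    have := (ContinuousLinearMap.mul ℝ 𝒜 (r E)).integrable_comp (hr.integrableOn hE)
    simpa [IntegrableOn] using this
  have hint2 := (hr.integrableOn_sq hE).smul (2 : ℝ)
  have hder : ∀ l ∈ Set.Ioi (0 : ℝ),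
      HasDerivAt (fun l : ℝ => (2 * √l) • (r E * r (E + l)))
        ((2 : ℝ) • ((l ^ (-(1 / 2) : ℝ)) • (r (E + l) * r (E + l))) -
          (l ^ (-(1 / 2) : ℝ)) • (r E * r (E + l))) l := by
    intro l hl
    have hl : 0 < l := hl
    have hEl : 0 < E + l := by positivity
    have h1 := ((Real.hasDerivAt_sqrt hl.ne').const_mul 2).smul
      ((hr.hasDerivAt_add hEl).const_mul (r E))
    refine h1.congr_deriv ?_
    have hs : 0 < √l := Real.sqrt_pos.2 hl
    have h2 : l ^ (-(1 / 2) : ℝ) = (√l)⁻¹ := by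
      rw [Real.rpow_neg hl.le, ← Real.sqrt_eq_rpow]
    have h3 := hr.identity E (E + l) hE hEl
    have h4 : r (E + l) * r (E + l) = r E * r (E + l) - l • (r E * (r (E + l) * r (E + l))) := by
      have := congrArg (· * r (E + l)) h3
      simp only [sub_mul, smul_mul_assoc, add_sub_cancel_left, mul_assoc] at this
      rw [← this]
      abel
    rw [h2, mul_neg, smul_neg]
    have h5 : (2 * √l : ℝ) = 2 * (√l)⁻¹ * l := by
      field_simp
      rw [Real.sq_sqrt hl.le]
    have h6 : (2 * (1 / (2 * √l)) : ℝ) = (√l)⁻¹ := by field_simp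
    rw [h6, h5]
    conv_rhs => rw [h4]
    module
  have hcont : ContinuousWithinAt (fun l : ℝ => (2 * √l) • (r E * r (E + l))) (Set.Ici 0) 0 := by
    apply ContinuousAt.continuousWithinAt
    have h1 : ContinuousAt (fun l => r (E + l)) 0 :=
      (hr.hasDerivAt_add (E := E) (l := 0) (by simpa using hE)).continuousAt
    have h2 : ContinuousAt (fun l : ℝ => 2 * √l) 0 := by fun_prop
    exact h2.smul (h1.const_mul _)
  have hlim : Tendsto (fun l : ℝ => (2 * √l) • (r E * r (E + l))) atTop (𝓝 0) := by
    have h0 : Tendsto (fun l : ℝ => 2 * E⁻¹ * (√l)⁻¹) atTop (𝓝 0) := by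
      simpa using (tendsto_inv_atTop_zero.comp Real.tendsto_sqrt_atTop).const_mul (2 * E⁻¹)
    refine squeeze_zero_norm' ?_ h0
    filter_upwards [eventually_gt_atTop 0] with l hl
    have hs : 0 < √l := Real.sqrt_pos.2 hl
    rw [norm_smul, Real.norm_of_nonneg (by positivity)]
    have h1 : ‖r E * r (E + l)‖ ≤ E⁻¹ * l⁻¹ :=
      (norm_mul_le _ _).trans (mul_le_mul (hr.norm_le _ hE)
        ((hr.norm_le _ (by positivity)).trans (inv_anti₀ hl (by linarith))) (norm_nonneg _)
        (by positivity))
    calc 2 * √l * ‖r E * r (E + l)‖ ≤ 2 * √l * (E⁻¹ * l⁻¹) := by gcongr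
      _ = 2 * E⁻¹ * (√l)⁻¹ := by
        nth_rewrite 2 [← Real.sq_sqrt hl.le]
        field_simp
  have := integral_Ioi_of_hasDerivAt_of_tendsto hcont hder (hint2.sub hint1) hlim
  have h2 := integral_sub hint2 hint1
  simp only [Real.sqrt_zero, mul_zero, zero_smul, sub_zero] at this
  rw [hr.mul_sqrtIntegral hE, ← sub_eq_zero, ← integral_smul]
  exact h2.symm.trans this

theorem hasDerivAt_sqrtIntegral {E : ℝ} (hE : 0 < E) :
    HasDerivAt (sqrtIntegral r) (-(1 / 2 : ℝ) • (r E * sqrtIntegral r E)) E := by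
  have hd : 0 < E / 2 := by positivity
  have key := hasDerivAt_integral_of_dominated_loc_of_deriv_le
    (μ := volume.restrict (Set.Ioi (0 : ℝ)))
    (F := fun x l => (l ^ (-(1 / 2) : ℝ)) • r (x + l))
    (F' := fun x l => -((l ^ (-(1 / 2) : ℝ)) • (r (x + l) * r (x + l)))) (x₀ := E)
    (bound := fun l => l ^ (-(1 / 2) : ℝ) * (E / 2 + l)⁻¹ * (E / 2)⁻¹)
    (s := Set.Ioi (E / 2)) (Ioi_mem_nhds (by linarith)) ?_ (hr.integrableOn hE) ?_ ?_
    ((integrableOn_rpow_mul_inv hd).mul_const _) ?_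
  · have h := key.2
    rw [integral_neg] at h
    refine h.congr_deriv ?_
    rw [← hr.integral_sq hE, smul_smul]
    norm_num
  · filter_upwards [lt_mem_nhds hE] with x hx
    exact (hr.continuousOn_integrand hx).aestronglyMeasurable measurableSet_Ioi
  · exact (hr.continuousOn_integrand_sq hE).neg.aestronglyMeasurable measurableSet_Ioi
  · filter_upwards [ae_restrict_mem measurableSet_Ioi] with l hl x hx
    rw [norm_neg]
    exact hr.norm_integrand_sq_le hd (le_of_lt hx) hl
  · filter_upwards [ae_restrict_mem measurableSet_Ioi] with l hl x hx
    have hl : 0 < l := hl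
    have hx : E / 2 < x := hx
    have := ((hr.hasDerivAt (x := x + l) (by linarith)).comp_add_const x l).const_smul
      (l ^ (-(1 / 2) : ℝ))
    rw [smul_neg] at this
    exact this

/-- With `J = sqrtIntegral r`, formally `J(x)²` is a multiple of `r x`, and `r e = r x + (x - e) r x
r e`. So the right side should not depend on `E`; the equation `J' = -r J / 2` proves that without
knowing the multiple, and at `E = e` the second term drops out. -/
theorem sqrtIntegral_sq_eq {e E : ℝ} (he : 0 < e) (heE : e ≤ E) :
    sqrtIntegral r e * sqrtIntegral r e =
      sqrtIntegral r E * sqrtIntegral r E +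
        (E - e) • (sqrtIntegral r E * (sqrtIntegral r E * r e)) := by
  set J := sqrtIntegral r with hJ
  let f : ℝ → 𝒜 := fun x => J x * J x + (x - e) • (J x * J x * r e)
  have hder : ∀ x, 0 < x → HasDerivAt f 0 x := by
    intro x hx
    have h1 := hr.hasDerivAt_sqrtIntegral hx
    rw [← hJ] at h1
    have h2 := h1.mul h1
    have h3 := ((hasDerivAt_id x).sub_const e).smul (h2.mul_const (r e))
    have h4 := h2.add h3
    refine h4.congr_deriv ?_
    have hc : J x * r x = r x * J x := hr.sqrtIntegral_comm hx hx
    have hce : J x * r e = r e * J x := hr.sqrtIntegral_comm he hx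
    have hid := hr.identity e x he hx
    have e1 : (-(1 / 2 : ℝ) • (r x * J x)) * J x + J x * (-(1 / 2 : ℝ) • (r x * J x)) =
        -(r x * (J x * J x)) := by
      rw [mul_smul_comm, smul_mul_assoc, ← mul_assoc (J x), hc, mul_assoc]
      module
    simp only [e1, id, one_smul, Pi.mul_apply]
    have e2 : J x * J x * r e = r e * (J x * J x) := by
      rw [mul_assoc, hce, ← mul_assoc, hce, mul_assoc]
    have e3 : r x * (J x * J x) * r e = r e * r x * (J x * J x) := by
      rw [mul_assoc, e2, ← mul_assoc, hr.mul_comm hx he]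
    rw [neg_mul, e2, e3]
    have e4 : (x - e) • (r e * r x * (J x * J x)) = (r e - r x) * (J x * J x) := by
      rw [hid, smul_mul_assoc]
    rw [smul_neg, e4, sub_mul]
    abel
  have hconst := constant_of_has_deriv_right_zero (f := f) (a := e) (b := E)
    (fun x hx => (hder x (he.trans_le hx.1)).continuousAt.continuousWithinAt)
    (fun x hx => (hder x (he.trans_le hx.1)).hasDerivWithinAt) E ⟨heE, le_rfl⟩
  simp only [f, sub_self, zero_smul, add_zero] at hconst
  rw [← hconst, mul_assoc (J E)]

/-- The resolvent identity gives `r(E + l) r(e) = (r(e) - r(E + l)) / (E - e + l)`. The first part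
integrates to exactly `π / √(E - e)` times `r e`; the second is smaller by a factor `1 / E`. -/
theorem norm_sqrt_smul_sub_le {e E : ℝ} (he : 0 < e) (heE : e < E) :
    ‖√(E - e) • (sqrtIntegral r E * r e) - Real.pi • r e‖ ≤ Real.pi / E := by
  have hE : 0 < E := he.trans heE
  have hD : 0 < E - e := sub_pos.2 heE
  have hsD := Real.sqrt_pos.2 hD
  have h1 : IntegrableOn (fun l : ℝ => (l ^ (-(1 / 2) : ℝ) * (E - e + l)⁻¹) • r e) (Set.Ioi 0) :=
    (integrableOn_rpow_mul_inv hD).smul_const _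
  have hbd : ∀ l : ℝ, 0 < l → ‖(l ^ (-(1 / 2) : ℝ) * (E - e + l)⁻¹) • r (E + l)‖ ≤
      l ^ (-(1 / 2) : ℝ) * (E - e + l)⁻¹ * E⁻¹ := by
    intro l hl
    rw [norm_smul, Real.norm_of_nonneg (by positivity)]
    gcongr
    exact (hr.norm_le _ (by positivity)).trans (inv_anti₀ hE (by linarith))
  have hint := (integrableOn_rpow_mul_inv hD).mul_const E⁻¹
  have hcont : ContinuousOn (fun l : ℝ => (l ^ (-(1 / 2) : ℝ) * (E - e + l)⁻¹) • r (E + l))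
      (Set.Ioi 0) := by
    have hh : ContinuousOn (fun l : ℝ => (E - e + l)⁻¹) (Set.Ioi 0) :=
      ContinuousOn.inv₀ (by fun_prop) fun l (hl : 0 < l) => (by positivity : E - e + l ≠ 0)
    have := hh.smul (hr.continuousOn_integrand hE)
    refine this.congr fun l _ => ?_
    simp only [Pi.smul_apply', smul_smul, _root_.mul_comm]
  have h2 : IntegrableOn (fun l : ℝ => (l ^ (-(1 / 2) : ℝ) * (E - e + l)⁻¹) • r (E + l))
      (Set.Ioi 0) := by
    refine hint.mono' (hcont.aestronglyMeasurable measurableSet_Ioi) ?_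
    filter_upwards [ae_restrict_mem measurableSet_Ioi] with l hl
    exact hbd l hl
  have h3 : sqrtIntegral r E * r e = (Real.pi / √(E - e)) • r e -
      ∫ l in Set.Ioi (0 : ℝ), (l ^ (-(1 / 2) : ℝ) * (E - e + l)⁻¹) • r (E + l) := by
    rw [← integral_rpow_mul_inv hD, ← integral_smul_const, ← integral_sub h1 h2,
      hr.sqrtIntegral_mul hE]
    refine setIntegral_congr_fun measurableSet_Ioi fun l (hl : 0 < l) => ?_
    have hEl : 0 < E + l := by positivity
    have hne : E - e + l ≠ 0 := by positivity
    have := hr.identity e (E + l) he hEl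
    rw [← smul_sub, this, smul_smul, hr.mul_comm he hEl]
    congr 1
    rw [mul_assoc, show E + l - e = E - e + l by ring, inv_mul_cancel₀ hne, mul_one]
  have h4 : ‖∫ l in Set.Ioi (0 : ℝ), (l ^ (-(1 / 2) : ℝ) * (E - e + l)⁻¹) • r (E + l)‖ ≤
      Real.pi / √(E - e) * E⁻¹ := by
    rw [← integral_rpow_mul_inv hD, ← integral_mul_const]
    refine norm_integral_le_of_norm_le hint ?_
    filter_upwards [ae_restrict_mem measurableSet_Ioi] with l hl
    exact hbd l hl
  rw [h3, smul_sub, smul_smul, mul_div_cancel₀ _ hsD.ne', sub_sub_cancel_left, norm_neg, norm_smul,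
    Real.norm_of_nonneg hsD.le]
  calc _ ≤ √(E - e) * (Real.pi / √(E - e) * E⁻¹) := by gcongr
    _ = Real.pi / E := by field_simp

/-- Let `E → ∞` in `sqrtIntegral_sq_eq`: the square of the integral at `E` is `O(1 / E)`, while `√(E
- e)` times that integral stays bounded and acts on `r e` asymptotically as `π`. -/
theorem sqrtIntegral_mul_self {e : ℝ} (he : 0 < e) :
    sqrtIntegral r e * sqrtIntegral r e = Real.pi ^ 2 • r e := by
  set J := sqrtIntegral r with hJ
  rw [← sub_eq_zero, ← norm_eq_zero]
  refine le_antisymm ?_ (norm_nonneg _)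
  have hlim : Tendsto (fun E : ℝ => Real.pi ^ 2 / E + Real.pi * (Real.pi / E) + Real.pi *
      (Real.pi / E)) atTop (𝓝 0) := by
    have h (c : ℝ) : Tendsto (fun E : ℝ => c / E) atTop (𝓝 0) :=
      tendsto_const_nhds.div_atTop tendsto_id
    simpa using ((h _).add ((h _).const_mul Real.pi)).add ((h _).const_mul Real.pi)
  refine ge_of_tendsto hlim ?_
  filter_upwards [eventually_gt_atTop e] with E heE
  have hE : 0 < E := he.trans heE
  have hD : 0 < E - e := sub_pos.2 heE
  have hpi := Real.pi_pos
  have hJn : ‖J E‖ ≤ Real.pi / √E := hr.norm_sqrtIntegral_le hE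
  set W : 𝒜 := √(E - e) • J E with hW
  have hWn : ‖W‖ ≤ Real.pi := by
    rw [hW, norm_smul, Real.norm_of_nonneg (Real.sqrt_nonneg _)]
    have : √(E - e) ≤ √E := Real.sqrt_le_sqrt (by linarith)
    have hs := Real.sqrt_pos.2 hE
    calc _ ≤ √E * (Real.pi / √E) := by gcongr
      _ = Real.pi := by field_simp
  have hWr : ‖W * r e - Real.pi • r e‖ ≤ Real.pi / E := by
    rw [hW, smul_mul_assoc]
    exact hr.norm_sqrt_smul_sub_le he heE
  have hdec : J e * J e - Real.pi ^ 2 • r e = J E * J E + W * (W * r e - Real.pi • r e) +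
      Real.pi • (W * r e - Real.pi • r e) := by
    have h1 : (E - e) • (J E * (J E * r e)) = W * (W * r e) := by
      rw [hW, smul_mul_assoc, smul_mul_assoc, mul_smul_comm, smul_smul,
        Real.mul_self_sqrt hD.le]
    rw [hJ, hr.sqrtIntegral_sq_eq he heE.le, ← hJ, h1, mul_sub, mul_smul_comm]
    module
  rw [hdec]
  refine (norm_add₃_le).trans ?_
  gcongr
  · calc ‖J E * J E‖ ≤ ‖J E‖ * ‖J E‖ := norm_mul_le _ _
      _ ≤ (Real.pi / √E) * (Real.pi / √E) := by gcongr
      _ = Real.pi ^ 2 / E := by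
        rw [div_mul_div_comm, Real.mul_self_sqrt hE.le, sq]
  · exact (norm_mul_le _ _).trans (by gcongr)
  · rw [norm_smul, Real.norm_of_nonneg hpi.le]
    gcongr

end IsPseudoResolvent

end PseudoResolvent

/-! ### Preliminaries on Hilbert spaces -/

section Prelim

variable {H F V : Type*}
variable [NormedAddCommGroup H] [InnerProductSpace ℂ H]
variable [NormedAddCommGroup F] [InnerProductSpace ℂ F]
variable [NormedAddCommGroup V] [InnerProductSpace ℂ V]

theorem isUnit_of_le_re_inner [CompleteSpace V] (N : V →L[ℂ] V) {κ : ℝ} (hκ : 0 < κ)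
    (h : ∀ u, κ * ‖u‖ ^ 2 ≤ (⟪u, N u⟫_ℂ).re) : IsUnit N := by
  refine N.isUnit_of_forall_le_norm_inner_map (c := ⟨κ, hκ.le⟩) hκ fun u => ?_
  rw [norm_inner_symm, mul_comm]
  exact (h u).trans ((le_abs_self _).trans (Complex.abs_re_le_norm _))

theorem denseRange_of_adjoint_injective [CompleteSpace H] [CompleteSpace F] (T : H →L[ℂ] F)
    (h : ∀ y, T.adjoint y = 0 → y = 0) : DenseRange T := by
  have h1 := T.orthogonal_range
  have h2 : LinearMap.ker (T.adjoint : F →ₗ[ℂ] H) = ⊥ :=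
    (Submodule.eq_bot_iff _).2 fun y hy => h y hy
  have h3 := (Submodule.topologicalClosure_eq_top_iff (K := LinearMap.range (T : H →ₗ[ℂ] F))).2
    (h1.trans h2)
  have h4 := Submodule.dense_iff_topologicalClosure_eq_top.2 h3
  exact h4

/-- Polarization: a sesquilinear form bounded on the diagonal by a Hilbert norm is bounded. -/
theorem norm_sesq_le {X : Type*} [AddCommGroup X] [Module ℂ X] (s : X →ₗ⋆[ℂ] X →ₗ[ℂ] ℂ)
    (n : X →ₗ[ℂ] V) (hn : Function.Injective n) {M : ℝ} (h : ∀ u, ‖s u u‖ ≤ M * ‖n u‖ ^ 2)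
    (u v : X) : ‖s u v‖ ≤ 2 * M * (‖n u‖ * ‖n v‖) := by
  have key (u v : X) : ‖s u v‖ ≤ M * (‖n u‖ ^ 2 + ‖n v‖ ^ 2) := by
    have h1 : 4 * s u v = s (u + v) (u + v) - s (u - v) (u - v)
        - Complex.I * (s (u + Complex.I • v) (u + Complex.I • v)
          - s (u - Complex.I • v) (u - Complex.I • v)) := by
      simp only [map_add, map_sub, LinearMap.add_apply, LinearMap.sub_apply,
        LinearMap.map_smulₛₗ, LinearMap.smul_apply, map_smul, smul_eq_mul, Complex.conj_I]
      linear_combination (2 * s u v - 2 * s v u) * Complex.I_sq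
    have p1 := parallelogram_law_with_norm ℂ (n u) (n v)
    have p2 := parallelogram_law_with_norm ℂ (n u) (Complex.I • n v)
    rw [norm_smul, Complex.norm_I, one_mul] at p2
    simp only [← map_add, ← map_sub, ← LinearMap.map_smul] at p1 p2
    have h2 : 4 * ‖s u v‖ ≤ ‖s (u + v) (u + v)‖ + ‖s (u - v) (u - v)‖ +
        (‖s (u + Complex.I • v) (u + Complex.I • v)‖ +
          ‖s (u - Complex.I • v) (u - Complex.I • v)‖) := by
      have : ‖4 * s u v‖ = 4 * ‖s u v‖ := by simp
      rw [← this, h1]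
      refine (norm_sub_le _ _).trans (add_le_add (norm_sub_le _ _) ?_)
      rw [norm_mul, Complex.norm_I, one_mul]
      exact norm_sub_le _ _
    have hb1 : ‖s (u + v) (u + v)‖ ≤ M * ‖n (u + v)‖ ^ 2 := h _
    have hb2 : ‖s (u - v) (u - v)‖ ≤ M * ‖n (u - v)‖ ^ 2 := h _
    have hb3 := h (u + Complex.I • v)
    have hb4 := h (u - Complex.I • v)
    nlinarith [congrArg (M * ·) p1, congrArg (M * ·) p2]
  rcases eq_or_ne u 0 with rfl | hu
  · simp
  rcases eq_or_ne v 0 with rfl | hv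
  · simp
  have hu' : 0 < ‖n u‖ := norm_pos_iff.2 ((map_ne_zero_iff n hn).2 hu)
  have hv' : 0 < ‖n v‖ := norm_pos_iff.2 ((map_ne_zero_iff n hn).2 hv)
  -- Rescaling `u` and `v` to equal `n`-norms turns the sum of squares in `key` into a product.
  have h3 := key ((‖n v‖ : ℂ) • u) ((‖n u‖ : ℂ) • v)
  simp only [LinearMap.map_smulₛₗ, LinearMap.smul_apply, map_smul, smul_eq_mul, norm_mul,
    norm_smul, Complex.conj_ofReal, Complex.norm_real, norm_norm] at h3
  have h4 : (‖n u‖ * ‖n v‖) * ‖s u v‖ ≤ (‖n u‖ * ‖n v‖) * (2 * M * (‖n u‖ * ‖n v‖)) := by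
    nlinarith [h3]
  exact le_of_mul_le_mul_left h4 (by positivity)

/-- The adjoint of a densely defined closed operator is densely defined. -/
theorem dense_adjoint_domain [CompleteSpace H] [CompleteSpace F] {B : H →ₗ.[ℂ] F}
    (hc : B.IsClosed) : Dense (B†.domain : Set F) := by
  rw [Submodule.dense_iff_topologicalClosure_eq_top, Submodule.topologicalClosure_eq_top_iff,
    Submodule.eq_bot_iff]
  intro y hy
  let e := WithLp.prodContinuousLinearEquiv 2 ℂ H F
  let K : Submodule ℂ (WithLp 2 (H × F)) := B.graph.comap (e : WithLp 2 (H × F) →ₗ[ℂ] H × F)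
  have hK : IsClosed (K : Set (WithLp 2 (H × F))) := IsClosed.preimage e.continuous hc
  have hK' : Kᗮᗮ = K := by
    rw [Submodule.orthogonal_orthogonal_eq_closure]
    exact hK.submodule_topologicalClosure_eq
  -- The vectors orthogonal to the graph have second component in the domain of `B†`. Hence `(0, y)`
  -- is orthogonal to all of them and lies in the closed graph, so `y = B 0`.
  have hmem : WithLp.toLp 2 ((0 : H), y) ∈ Kᗮᗮ := by
    rw [Submodule.mem_orthogonal]
    intro u hu
    have hu' : ∀ x : B.domain, ⟪(x : H), u.fst⟫_ℂ + ⟪B x, u.snd⟫_ℂ = 0 := by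
      intro x
      have hx : WithLp.toLp 2 ((x : H), B x) ∈ K := B.mem_graph x
      have := (Submodule.mem_orthogonal _ _).1 hu _ hx
      simpa [WithLp.prod_inner_apply] using this
    have hd : u.snd ∈ B†.domain := by
      refine LinearPMap.mem_adjoint_domain_of_exists _ ⟨-u.fst, fun x => ?_⟩
      have h := congrArg (starRingEnd ℂ) (hu' x)
      simp only [map_add, inner_conj_symm, map_zero] at h
      rw [inner_neg_left]
      linear_combination -h
    have := (Submodule.mem_orthogonal _ _).1 hy _ hd
    simpa [WithLp.prod_inner_apply] using this
  rw [hK'] at hmem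
  have hg : ((0 : H), y) ∈ B.graph := hmem
  exact B.graph_fst_eq_zero_snd hg rfl

/-! ### Resolvents -/

/-- In terms of the graph no domain proofs occur: the graph is a closed set determined by `R` and
`z`, which yields closedness of `T` and uniqueness of the operator. -/
theorem isResolventAt_iff {T : H →ₗ.[ℂ] H} {z : ℂ} {R : H →L[ℂ] H} :
    IsResolventAt T z R ↔ ∀ u f, (u, f) ∈ T.graph ↔ R (f - z • u) = u := by
  constructor
  · rintro ⟨h1, h2⟩ u f
    constructor
    · intro h
      obtain ⟨y, rfl, rfl⟩ := (LinearPMap.mem_graph_iff T).1 h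
      exact h2 y
    · intro h
      obtain ⟨hd, he⟩ := h1 (f - z • u)
      refine (LinearPMap.mem_graph_iff T).2 ⟨⟨_, hd⟩, h, ?_⟩
      have he' : T ⟨R (f - z • u), hd⟩ - z • u = f - z • u :=
        (congrArg (fun x => T ⟨R (f - z • u), hd⟩ - z • x) h.symm).trans he
      exact sub_left_injective he'
  · intro h
    constructor
    · intro f
      have := (h (R f) (f + z • R f)).2 (by simp)
      obtain ⟨y, hy, hy'⟩ := (LinearPMap.mem_graph_iff T).1 this
      simp only at hy hy'
      refine ⟨hy ▸ y.2, ?_⟩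
      have e : (⟨R f, hy ▸ y.2⟩ : T.domain) = y := Subtype.ext hy.symm
      rw [e, hy']
      simp
    · intro u
      exact (h u (T u)).1 (T.mem_graph u)

namespace IsResolventAt

variable {T : H →ₗ.[ℂ] H} {z w : ℂ} {R R' : H →L[ℂ] H}

theorem unique (h : IsResolventAt T z R) (h' : IsResolventAt T z R') : R = R' := by
  ext f
  obtain ⟨hd, he⟩ := h'.1 f
  have := h.2 ⟨R' f, hd⟩
  rwa [he] at this

theorem resolv_eq (h : IsResolventAt T z R) : resolv T z = R := by
  have hex : ∃ R : H →L[ℂ] H, IsResolventAt T z R := ⟨R, h⟩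
  rw [resolv, dif_pos hex]
  exact hex.choose_spec.unique h

theorem operator_unique {T' : H →ₗ.[ℂ] H} (h : IsResolventAt T z R) (h' : IsResolventAt T' z R) :
    T = T' := by
  refine LinearPMap.eq_of_eq_graph (Submodule.ext fun ⟨u, f⟩ => ?_)
  rw [isResolventAt_iff.1 h, isResolventAt_iff.1 h']

theorem isClosed (h : IsResolventAt T z R) : T.IsClosed := by
  have : (T.graph : Set (H × H)) = {x | R (x.2 - z • x.1) = x.1} := by
    ext ⟨u, f⟩
    exact isResolventAt_iff.1 h u f
  rw [LinearPMap.IsClosed, this]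
  exact isClosed_eq (by fun_prop) (by fun_prop)

theorem mem_domain_iff (h : IsResolventAt T z R) {u : H} : u ∈ T.domain ↔ ∃ f, R f = u := by
  constructor
  · exact fun hu => ⟨_, h.2 ⟨u, hu⟩⟩
  · rintro ⟨f, rfl⟩
    exact (h.1 f).1

theorem injective (h : IsResolventAt T z R) {f : H} (hf : R f = 0) : f = 0 := by
  obtain ⟨hd, he⟩ := h.1 f
  have : (⟨R f, hd⟩ : T.domain) = 0 := Subtype.ext hf
  rw [this, hf] at he
  simpa using he.symm

theorem sub_eq (h : IsResolventAt T z R) (h' : IsResolventAt T w R') :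
    R - R' = (z - w) • (R * R') := by
  ext f
  obtain ⟨hd, he⟩ := h'.1 f
  have h1 := h.2 ⟨R' f, hd⟩
  have h2 : T ⟨R' f, hd⟩ - z • R' f = f + (w - z) • R' f := by
    rw [sub_eq_iff_eq_add.1 he]
    module
  simp only at h1
  rw [h2, map_add, map_smul] at h1
  change R f - R' f = (z - w) • R (R' f)
  rw [sub_eq_iff_eq_add, ← sub_eq_iff_eq_add']
  nth_rewrite 2 [← h1]
  module

theorem shift_iff {c : ℂ} : IsResolventAt (shift T c) z R ↔ IsResolventAt T (z - c) R := by
  have key (u : T.domain) : shift T c u - z • (u : H) = T u - (z - c) • (u : H) := by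
    have : shift T c u = T u + c • (u : H) := rfl
    rw [this]
    module
  constructor
  · rintro ⟨h1, h2⟩
    exact ⟨fun f => ⟨(h1 f).1, by rw [← key]; exact (h1 f).2⟩,
      fun u => by rw [← key]; exact h2 u⟩
  · rintro ⟨h1, h2⟩
    exact ⟨fun f => ⟨(h1 f).1, (key _).trans (h1 f).2⟩,
      fun u => (congrArg R (key u)).trans (h2 u)⟩

theorem adjoint [CompleteSpace H] (h : IsResolventAt T z R) (hT : Dense (T.domain : Set H)) :
    IsResolventAt T† (starRingEnd ℂ z) R.adjoint := by
  constructor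
  · intro f
    have key : ∀ x : T.domain,
        ⟪f + starRingEnd ℂ z • R.adjoint f, (x : H)⟫_ℂ = ⟪R.adjoint f, T x⟫_ℂ := by
      intro x
      have h1 : ⟪R.adjoint f, T x - z • (x : H)⟫_ℂ = ⟪f, (x : H)⟫_ℂ := by
        rw [ContinuousLinearMap.adjoint_inner_left, h.2 x]
      rw [inner_sub_right, inner_smul_right] at h1
      rw [inner_add_left, inner_smul_left, Complex.conj_conj]
      linear_combination -h1
    have hd : R.adjoint f ∈ T†.domain := LinearPMap.mem_adjoint_domain_of_exists _ ⟨_, key⟩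
    refine ⟨hd, ?_⟩
    rw [LinearPMap.adjoint_apply_eq hT ⟨_, hd⟩ key]
    simp
  · intro u
    refine ext_inner_right ℂ fun g => ?_
    obtain ⟨hd, he⟩ := h.1 g
    have h1 := LinearPMap.adjoint_isFormalAdjoint hT u ⟨R g, hd⟩
    rw [ContinuousLinearMap.adjoint_inner_left, inner_sub_left, inner_smul_left, Complex.conj_conj]
    simp only at h1
    rw [h1, ← inner_smul_right, ← inner_sub_right, he]

end IsResolventAt

theorem IsBoundedClosure.bddClosure_eq {S : F →ₗ.[ℂ] H} {C : F →L[ℂ] H}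
    (h : IsBoundedClosure S C) : bddClosure S = C := by
  have hex : ∃ C : F →L[ℂ] H, IsBoundedClosure S C := ⟨C, h⟩
  rw [bddClosure, dif_pos hex]
  refine ContinuousLinearMap.coeFn_injective (Continuous.ext_on h.1
    (hex.choose.continuous) C.continuous fun x hx => ?_)
  exact (hex.choose_spec.2 ⟨x, hx⟩).trans (h.2 ⟨x, hx⟩).symm

/-! ### Sectors -/

theorem abs_arg_le_iff {ζ : ℂ} {θ : ℝ} (h0 : 0 ≤ θ) (h1 : θ < Real.pi / 2) (hζ : 0 < ζ.re) :
    |ζ.arg| ≤ θ ↔ |ζ.im| ≤ Real.tan θ * ζ.re := by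
  have ha : |ζ.arg| < Real.pi / 2 := Complex.abs_arg_lt_pi_div_two_iff.2 (Or.inl hζ)
  rw [abs_lt] at ha
  have hpi := Real.pi_pos
  have e1 : ζ.arg = Real.arctan (ζ.im / ζ.re) := by
    rw [← Complex.tan_arg, Real.arctan_tan ha.1 ha.2]
  have e2 : θ = Real.arctan (Real.tan θ) := (Real.arctan_tan (by linarith) h1).symm
  rw [e1]
  nth_rewrite 1 [e2]
  rw [abs_le, ← Real.arctan_neg, Real.arctan_strictMono.le_iff_le, Real.arctan_strictMono.le_iff_le,
    ← abs_le, abs_div, abs_of_pos hζ, div_le_iff₀ hζ]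

/-- Unlike the argument, these real inequalities are homogeneous under scaling of vectors. The
vertex is included since `arg 0 = 0`. -/
theorem mem_sector_iff {ζ : ℂ} {γ θ : ℝ} (h0 : 0 ≤ θ) (h1 : θ < Real.pi / 2) :
    ζ ∈ sector γ θ ↔ γ ≤ ζ.re ∧ |ζ.im| ≤ Real.tan θ * (ζ.re - γ) := by
  have key := abs_arg_le_iff (ζ := ζ - γ) h0 h1
  simp only [Complex.sub_re, Complex.sub_im, Complex.ofReal_re, Complex.ofReal_im, sub_zero,
    sub_pos] at key
  change |(ζ - (γ : ℂ)).arg| ≤ θ ↔ _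
  constructor
  · intro h
    rcases Complex.abs_arg_lt_pi_div_two_iff.1 (h.trans_lt h1) with h2 | h2
    · have h2 : γ < ζ.re := by simpa using h2
      exact ⟨h2.le, (key h2).1 h⟩
    · rw [sub_eq_zero.1 h2]
      simp
  · rintro ⟨h2, h3⟩
    rcases h2.lt_or_eq with h4 | h4
    · exact (key h4).2 h3
    · have : ζ - (γ : ℂ) = 0 := by
        apply Complex.ext
        · simp [← h4]
        · rw [← h4, sub_self, mul_zero] at h3
          simpa using h3
      rw [this]
      simpa using h0

end Prelim

section Forms

variable {H F V : Type*}
variable [NormedAddCommGroup H] [InnerProductSpace ℂ H]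
variable [NormedAddCommGroup F] [InnerProductSpace ℂ F]
variable [NormedAddCommGroup V] [InnerProductSpace ℂ V]

/-! ### Numerical ranges -/

theorem mem_sector_scaled {ζ : ℂ} {c θ t : ℝ} (h0 : 0 ≤ θ) (h1 : θ < Real.pi / 2) (ht : 0 < t)
    (h : ((t⁻¹ : ℝ) : ℂ) ^ 2 * ζ ∈ sector c θ) :
    c * t ^ 2 ≤ ζ.re ∧ |ζ.im| ≤ Real.tan θ * (ζ.re - c * t ^ 2) := by
  rw [mem_sector_iff h0 h1, ← Complex.ofReal_pow, Complex.re_ofReal_mul, Complex.im_ofReal_mul,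
    abs_mul, abs_of_pos (by positivity)] at h
  have e (x : ℝ) : t⁻¹ ^ 2 * x * t ^ 2 = x := by field_simp
  have ht2 : 0 < t ^ 2 := by positivity
  constructor
  · have := mul_le_mul_of_nonneg_right h.1 ht2.le
    rwa [e] at this
  · have := mul_le_mul_of_nonneg_right h.2 ht2.le
    rwa [e, mul_assoc, sub_mul, e] at this

theorem SesqForm.numRange_bounds {q : SesqForm H} {c θ : ℝ} (h0 : 0 ≤ θ) (h1 : θ < Real.pi / 2)
    (h : q.numRange ⊆ sector c θ) (u : q.domain) :
    c * ‖(u : H)‖ ^ 2 ≤ (q.form u u).re ∧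
      |(q.form u u).im| ≤ Real.tan θ * ((q.form u u).re - c * ‖(u : H)‖ ^ 2) := by
  rcases eq_or_ne u 0 with rfl | hu
  · simp
  have hpos : 0 < ‖(u : H)‖ := norm_pos_iff.2 (by simpa using hu)
  refine mem_sector_scaled h0 h1 hpos (h ⟨((‖(u : H)‖⁻¹ : ℝ) : ℂ) • u, ?_, ?_⟩)
  · rw [Submodule.coe_smul, norm_smul, Complex.norm_real, norm_inv, norm_norm,
      inv_mul_cancel₀ hpos.ne']
  · rw [map_smul, LinearMap.map_smulₛₗ, LinearMap.smul_apply, Complex.conj_ofReal, smul_eq_mul,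
      smul_eq_mul]
    ring

theorem numRange_bounds {T : H →ₗ.[ℂ] H} {c θ : ℝ} (h0 : 0 ≤ θ) (h1 : θ < Real.pi / 2)
    (h : numRange T ⊆ sector c θ) (u : T.domain) :
    c * ‖(u : H)‖ ^ 2 ≤ (⟪(u : H), T u⟫_ℂ).re ∧
      |(⟪(u : H), T u⟫_ℂ).im| ≤
        Real.tan θ * ((⟪(u : H), T u⟫_ℂ).re - c * ‖(u : H)‖ ^ 2) := by
  rcases eq_or_ne u 0 with rfl | hu
  · simp
  have hpos : 0 < ‖(u : H)‖ := norm_pos_iff.2 (by simpa using hu)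
  refine mem_sector_scaled h0 h1 hpos (h ⟨((‖(u : H)‖⁻¹ : ℝ) : ℂ) • u, ?_, ?_⟩)
  · rw [Submodule.coe_smul, norm_smul, Complex.norm_real, norm_inv, norm_norm,
      inv_mul_cancel₀ hpos.ne']
  · rw [LinearPMap.map_smul, Submodule.coe_smul, inner_smul_left, inner_smul_right,
      Complex.conj_ofReal]
    ring

/-! ### Operators associated with forms -/

/-- Density of the form domain makes `opGraph` single-valued; otherwise `toLinearPMap` would not
recover it. -/
theorem SesqForm.operator_graph {q : SesqForm H} (hq : Dense (q.domain : Set H)) :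
    q.operator.graph = q.opGraph := by
  refine Submodule.toLinearPMap_graph_eq _ ?_
  rintro ⟨v, f⟩ ⟨hv, h⟩ rfl
  refine hq.eq_zero_of_inner_right ℂ fun w hw => ?_
  rw [← h ⟨w, hw⟩]
  exact (q.form ⟨w, hw⟩).map_zero

theorem SesqForm.operator_domain_le (q : SesqForm H) : q.operator.domain ≤ q.domain := by
  rintro u ⟨⟨v, f⟩, ⟨hv, -⟩, rfl⟩
  exact hv

/-- The form `q` is represented on the Hilbert space `V`, embedded by `p` into `H`, by the bounded
operator `N`: its domain is `p V`, and `q(p x, p y) = ⟪x, N y⟫`. -/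
structure FormRep (q : SesqForm H) (p : V →L[ℂ] H) (N : V →L[ℂ] V) : Prop where
  injective : ∀ x, p x = 0 → x = 0
  mem_domain : ∀ u, u ∈ q.domain ↔ ∃ x, p x = u
  form_eq : ∀ x y (hx : p x ∈ q.domain) (hy : p y ∈ q.domain),
    q.form ⟨p x, hx⟩ ⟨p y, hy⟩ = ⟪x, N y⟫_ℂ
  coercive : ∃ E κ : ℝ, 0 < κ ∧ ∀ x, κ * ‖x‖ ^ 2 ≤ (⟪x, N x⟫_ℂ).re + E * ‖p x‖ ^ 2

variable [CompleteSpace H] [CompleteSpace V]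

/-- The operator representing the form of `T - z`. -/
def repShift (p : V →L[ℂ] H) (N : V →L[ℂ] V) (z : ℂ) : V →L[ℂ] V := N - z • (p.adjoint ∘L p)

theorem repShift_apply (p : V →L[ℂ] H) (N : V →L[ℂ] V) (z : ℂ) (x : V) :
    repShift p N z x = N x - z • p.adjoint (p x) := rfl

theorem re_inner_repShift (p : V →L[ℂ] H) (N : V →L[ℂ] V) (z : ℂ) (x : V) :
    (⟪x, repShift p N z x⟫_ℂ).re = (⟪x, N x⟫_ℂ).re - z.re * ‖p x‖ ^ 2 := by
  rw [repShift_apply, inner_sub_right, inner_smul_right, ContinuousLinearMap.adjoint_inner_right,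
    inner_self_eq_norm_sq_to_K]
  simp [← Complex.ofReal_pow]

namespace FormRep

variable {q : SesqForm H} {p : V →L[ℂ] H} {N : V →L[ℂ] V}

omit [CompleteSpace H] [CompleteSpace V] in
theorem mem (h : FormRep q p N) (x : V) : p x ∈ q.domain := (h.mem_domain _).2 ⟨x, rfl⟩

theorem mem_opGraph (h : FormRep q p N) {u f : H} :
    (u, f) ∈ q.opGraph ↔ ∃ x, p x = u ∧ N x = p.adjoint f := by
  constructor
  · rintro ⟨hu, hf⟩
    obtain ⟨x, rfl⟩ := (h.mem_domain _).1 hu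
    refine ⟨x, rfl, ext_inner_left ℂ fun y => ?_⟩
    rw [ContinuousLinearMap.adjoint_inner_right, ← h.form_eq y x (h.mem y) (h.mem x)]
    exact hf ⟨p y, h.mem y⟩
  · rintro ⟨x, rfl, hx⟩
    refine ⟨h.mem x, ?_⟩
    rintro ⟨w, hw⟩
    obtain ⟨y, rfl⟩ := (h.mem_domain _).1 hw
    refine (h.form_eq y x (h.mem y) (h.mem x)).trans ?_
    rw [hx, ContinuousLinearMap.adjoint_inner_right]

theorem isResolventAt (h : FormRep q p N) (hq : Dense (q.domain : Set H)) {z : ℂ} {L : V →L[ℂ] V}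
    (h1 : ∀ x, L (repShift p N z x) = x) (h2 : ∀ x, repShift p N z (L x) = x) :
    IsResolventAt q.operator z (p ∘L L ∘L p.adjoint) := by
  rw [isResolventAt_iff]
  intro u f
  rw [SesqForm.operator_graph hq, h.mem_opGraph]
  change _ ↔ p (L (p.adjoint (f - z • u))) = u
  constructor
  · rintro ⟨x, rfl, hx⟩
    have : p.adjoint (f - z • p x) = repShift p N z x := by
      rw [repShift_apply, map_sub, map_smul, hx]
    rw [this, h1]
  · intro hu
    refine ⟨_, hu, ?_⟩
    have := h2 (p.adjoint (f - z • u))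
    rw [repShift_apply, hu] at this
    rw [sub_eq_iff_eq_add.1 this, map_sub, map_smul]
    abel

theorem exists_inverse_of_coercive {z : ℂ} {κ : ℝ} (hκ : 0 < κ)
    (hc : ∀ x, κ * ‖x‖ ^ 2 ≤ (⟪x, N x⟫_ℂ).re - z.re * ‖p x‖ ^ 2) :
    ∃ L : V →L[ℂ] V, (∀ x, L (repShift p N z x) = x) ∧ ∀ x, repShift p N z (L x) = x := by
  obtain ⟨U, hU⟩ := isUnit_of_le_re_inner (repShift p N z) hκ fun x => by
    rw [re_inner_repShift]
    exact hc x
  refine ⟨↑U⁻¹, fun x => ?_, fun x => ?_⟩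
  · rw [← hU]
    exact congrArg (fun A : V →L[ℂ] V => A x) U.inv_mul
  · rw [← hU]
    exact congrArg (fun A : V →L[ℂ] V => A x) U.mul_inv

/-- If `z` belongs to the resolvent set, then `N - z p† p` is invertible on `V`. -/
theorem exists_inverse_of_mem_rho (h : FormRep q p N) (hq : Dense (q.domain : Set H)) {z w : ℂ}
    (hz : z ∈ rho q.operator) {L : V →L[ℂ] V}
    (h1 : ∀ x, L (repShift p N w x) = x) (h2 : ∀ x, repShift p N w (L x) = x) :
    ∃ L : V →L[ℂ] V, (∀ x, L (repShift p N z x) = x) ∧ ∀ x, repShift p N z (L x) = x := by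
  have hR := h.isResolventAt hq h1 h2
  obtain ⟨R, hR'⟩ := hz
  obtain ⟨ζ, hζ⟩ : ∃ ζ, ζ = z - w := ⟨_, rfl⟩
  have id1 (f : H) : R f - p (L (p.adjoint f)) = ζ • p (L (p.adjoint (R f))) := by
    have e := hR.sub_eq hR'
    have := congrArg (fun A : H →L[ℂ] H => A f) e
    have e' : p (L (p.adjoint f)) - R f = (w - z) • p (L (p.adjoint (R f))) := this
    rw [← neg_sub, e', hζ]
    module
  have id2 (f : H) : R f - p (L (p.adjoint f)) = ζ • R (p (L (p.adjoint f))) := by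
    rw [hζ]
    exact congrArg (fun A : H →L[ℂ] H => A f) (hR'.sub_eq hR)
  have hs (x : V) : repShift p N z x = repShift p N w x - ζ • p.adjoint (p x) := by
    simp only [repShift_apply, hζ]
    module
  -- The sought inverse `L'` satisfies `L' = L + ζ L p† p L'` and `L' = L + ζ L' p† p L`. Inserting
  -- the second into the first leaves `L'` only in `p L' p†`, which must be `R`.
  refine ⟨L + ζ • (L ∘L p.adjoint ∘L p ∘L L) + ζ ^ 2 • (L ∘L p.adjoint ∘L R ∘L p ∘L L),
    fun x => ?_, fun x => ?_⟩
  · change L (repShift p N z x) + ζ • L (p.adjoint (p (L (repShift p N z x)))) +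
      ζ ^ 2 • L (p.adjoint (R (p (L (repShift p N z x))))) = x
    have e1 : L (repShift p N z x) = x - ζ • L (p.adjoint (p x)) := by
      rw [hs, map_sub, map_smul, h1]
    have e2 := congrArg (fun y => L (p.adjoint y)) (id2 (p x))
    simp only [map_sub, map_smul] at e2
    simp only [e1, map_sub, map_smul]
    linear_combination (norm := module) ζ ^ 2 • e2
  · change repShift p N z (L x + ζ • L (p.adjoint (p (L x))) +
      ζ ^ 2 • L (p.adjoint (R (p (L x))))) = x
    have e2 := congrArg p.adjoint (id1 (p (L x)))
    simp only [map_sub, map_smul] at e2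
    simp only [map_add, map_smul, hs, h2]
    linear_combination (norm := module) ζ ^ 2 • e2

omit [CompleteSpace H] [CompleteSpace V] in
theorem normSq_eq (h : FormRep q p N) {c : ℝ} (x : V) (u : q.domain) (hu : p x = u) :
    q.normSq c u = (⟪x, N x⟫_ℂ).re + (1 - c) * ‖p x‖ ^ 2 := by
  have : u = ⟨p x, h.mem x⟩ := Subtype.ext hu.symm
  rw [SesqForm.normSq, this, h.form_eq]

omit [CompleteSpace V] in
theorem abs_im_le (x : V) : |(⟪x, N x⟫_ℂ).im| ≤ ‖N‖ * ‖x‖ ^ 2 := by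
  refine (Complex.abs_im_le_norm _).trans ((norm_inner_le_norm _ _).trans ?_)
  calc ‖x‖ * ‖N x‖ ≤ ‖x‖ * (‖N‖ * ‖x‖) := by gcongr; exact N.le_opNorm x
    _ = ‖N‖ * ‖x‖ ^ 2 := by ring

omit [CompleteSpace V] in
theorem re_le (x : V) : (⟪x, N x⟫_ℂ).re ≤ ‖N‖ * ‖x‖ ^ 2 := by
  refine (le_abs_self _).trans ((Complex.abs_re_le_norm _).trans
    ((norm_inner_le_norm _ _).trans ?_))
  calc ‖x‖ * ‖N x‖ ≤ ‖x‖ * (‖N‖ * ‖x‖) := by gcongr; exact N.le_opNorm x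
    _ = ‖N‖ * ‖x‖ ^ 2 := by ring

omit [CompleteSpace H] in
theorem isClosedSectorial (h : FormRep q p N) : q.IsClosedSectorial := by
  obtain ⟨E, κ, hκ, hc⟩ := h.coercive
  have ht : 0 ≤ ‖N‖ / κ := by positivity
  -- The imaginary part is at most `‖N‖ ‖x‖²`, and coercivity bounds `‖x‖²` by `κ⁻¹` times the real
  -- part shifted by `E`; the quotient is the tangent of the angle.
  refine ⟨-E, Real.arctan (‖N‖ / κ), Real.arctan_nonneg.2 ht, Real.arctan_lt_pi_div_two _, ?_, ?_⟩
  · rintro ζ ⟨u, hu, rfl⟩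
    obtain ⟨x, hx⟩ := (h.mem_domain _).1 u.2
    have hux : u = ⟨p x, h.mem x⟩ := Subtype.ext hx.symm
    rw [mem_sector_iff (Real.arctan_nonneg.2 ht) (Real.arctan_lt_pi_div_two _), Real.tan_arctan,
      hux, h.form_eq]
    have h1 := hc x
    rw [hx, hu] at h1
    have h2 : 0 ≤ κ * ‖x‖ ^ 2 := by positivity
    refine ⟨by linarith, (abs_im_le x).trans ?_⟩
    rw [div_mul_eq_mul_div, le_div_iff₀ hκ]
    nlinarith [norm_nonneg N]
  · intro s hs
    choose x hx using fun n => (h.mem_domain _).1 (s n).2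
    -- The form norm is equivalent to the norm of `V`, so completeness is inherited from `V`.
    have hlow (y : V) (u : q.domain) (hu : p y = u) : κ * ‖y‖ ^ 2 ≤ q.normSq (-E) u := by
      rw [h.normSq_eq y u hu]
      nlinarith [hc y, sq_nonneg ‖p y‖]
    have hup (y : V) (u : q.domain) (hu : p y = u) :
        q.normSq (-E) u ≤ (‖N‖ + |1 + E| * ‖p‖ ^ 2) * ‖y‖ ^ 2 := by
      rw [h.normSq_eq y u hu, add_mul, sub_neg_eq_add]
      refine add_le_add (re_le y) ?_
      rw [mul_assoc, ← mul_pow]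
      refine mul_le_mul (le_abs_self _) ?_ (by positivity) (abs_nonneg _)
      gcongr
      exact p.le_opNorm y
    have hx' : CauchySeq x := by
      rw [Metric.cauchySeq_iff']
      intro ε hε
      have hev := hs.eventually (gt_mem_nhds (show (0 : ℝ) < κ * ε ^ 2 by positivity))
      rw [← prod_atTop_atTop_eq] at hev
      obtain ⟨t, ht, hev⟩ := eventually_prod_self_iff'.1 hev
      obtain ⟨n0, hn0⟩ := mem_atTop_sets.1 ht
      refine ⟨n0, fun n hn => ?_⟩
      have h1 := hlow (x n - x n0) (s n - s n0) (by rw [map_sub, hx, hx]; rfl)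
      have h2 := hev n (hn0 n hn) n0 (hn0 n0 le_rfl)
      have h3 := lt_of_mul_lt_mul_left (h1.trans_lt h2) hκ.le
      rw [dist_eq_norm]
      exact lt_of_pow_lt_pow_left₀ 2 hε.le h3
    obtain ⟨y, hy⟩ := cauchySeq_tendsto_of_complete hx'
    refine ⟨⟨p y, h.mem y⟩, ?_⟩
    have h0 : Tendsto (fun n => (‖N‖ + |1 + E| * ‖p‖ ^ 2) * ‖x n - y‖ ^ 2) atTop (𝓝 0) := by
      simpa using ((tendsto_iff_norm_sub_tendsto_zero.1 hy).pow 2).const_mul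
        (‖N‖ + |1 + E| * ‖p‖ ^ 2)
    have hpy (n : ℕ) : p (x n - y) = ((s n - ⟨p y, h.mem y⟩ : q.domain) : H) := by
      rw [map_sub, hx]
      rfl
    refine squeeze_zero (fun n => ?_) (fun n => hup (x n - y) _ (hpy n)) h0
    exact le_trans (by positivity) (hlow _ _ (hpy n))

omit [CompleteSpace H] [CompleteSpace V] in
theorem of_range (p : V →L[ℂ] H) (hp : ∀ x, p x = 0 → x = 0) (N : V →L[ℂ] V)
    (hc : ∃ E κ : ℝ, 0 < κ ∧ ∀ x, κ * ‖x‖ ^ 2 ≤ (⟪x, N x⟫_ℂ).re + E * ‖p x‖ ^ 2) :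
    ∃ q : SesqForm H, FormRep q p N := by
  have hinj : Function.Injective (p : V →ₗ[ℂ] H) :=
    (injective_iff_map_eq_zero (p : V →ₗ[ℂ] H)).2 hp
  let e := LinearEquiv.ofInjective (p : V →ₗ[ℂ] H) hinj
  let s : V →ₗ⋆[ℂ] V →ₗ[ℂ] ℂ := (innerₛₗ ℂ).compl₂ (N : V →ₗ[ℂ] V)
  let q : SesqForm H :=
    { domain := LinearMap.range (p : V →ₗ[ℂ] H)
      form := (s.comp (e.symm : _ →ₗ[ℂ] V)).compl₂ (e.symm : _ →ₗ[ℂ] V) }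
  refine ⟨q, hp, fun u => Iff.rfl, fun x y hx hy => ?_, hc⟩
  have ex (x : V) (hx : p x ∈ LinearMap.range (p : V →ₗ[ℂ] H)) : e.symm ⟨p x, hx⟩ = x := by
    rw [LinearEquiv.symm_apply_eq]
    rfl
  change ⟪e.symm ⟨p x, hx⟩, N (e.symm ⟨p y, hy⟩)⟫_ℂ = _
  rw [ex, ex]

end FormRep

/-! ### Closed forms as Hilbert spaces -/

/-- The form domain, to be equipped with the form norm. -/
def FormSpace (q : SesqForm H) : Type _ := q.domain

instance (q : SesqForm H) : AddCommGroup (FormSpace q) := inferInstanceAs (AddCommGroup q.domain)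

instance (q : SesqForm H) : Module ℂ (FormSpace q) := inferInstanceAs (Module ℂ q.domain)

/-- The inclusion of the form domain. -/
def FormSpace.incl (q : SesqForm H) : FormSpace q →ₗ[ℂ] H := q.domain.subtype

/-- The form on the form domain. -/
def FormSpace.form (q : SesqForm H) : FormSpace q →ₗ⋆[ℂ] FormSpace q →ₗ[ℂ] ℂ := q.form

/-- The inner product of the form norm. -/
@[reducible]
def FormSpace.core (q : SesqForm H) (c : ℝ)
    (hc : ∀ u : FormSpace q, c * ‖FormSpace.incl q u‖ ^ 2 ≤ (FormSpace.form q u u).re) :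
    InnerProductSpace.Core ℂ (FormSpace q) where
  inner u v := (FormSpace.form q u v + starRingEnd ℂ (FormSpace.form q v u)) / 2 +
    (1 - c : ℝ) * ⟪FormSpace.incl q u, FormSpace.incl q v⟫_ℂ
  conj_inner_symm u v := by
    simp only [map_add, map_div₀, map_mul, Complex.conj_conj, inner_conj_symm, Complex.conj_ofReal,
      map_ofNat]
    ring
  re_inner_nonneg u := by
    have h := hc u
    have h2 := sq_nonneg ‖FormSpace.incl q u‖
    rw [inner_self_eq_norm_sq_to_K, Complex.add_conj, Complex.ofReal_mul, Complex.ofReal_ofNat,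
      mul_div_cancel_left₀ _ two_ne_zero]
    simp only [RCLike.re_to_complex, Complex.add_re, Complex.re_ofReal_mul]
    simp only [Complex.coe_algebraMap, ← Complex.ofReal_pow, Complex.ofReal_re]
    linarith
  add_left u v w := by
    simp only [map_add, LinearMap.add_apply, inner_add_left]
    ring
  smul_left u v r := by
    simp only [LinearMap.map_smulₛₗ, LinearMap.smul_apply, map_smul, smul_eq_mul, map_mul,
      inner_smul_left]
    ring
  definite u hu := by
    have h := hc u
    rw [inner_self_eq_norm_sq_to_K, Complex.add_conj, Complex.ofReal_mul, Complex.ofReal_ofNat,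
      mul_div_cancel_left₀ _ two_ne_zero] at hu
    have hu := congrArg Complex.re hu
    simp only [Complex.add_re, Complex.re_ofReal_mul] at hu
    simp only [Complex.coe_algebraMap, ← Complex.ofReal_pow, Complex.ofReal_re] at hu
    rw [Complex.zero_re] at hu
    have h2 : ‖FormSpace.incl q u‖ ^ 2 = 0 := by nlinarith [sq_nonneg ‖FormSpace.incl q u‖]
    have h3 : FormSpace.incl q u = 0 := by simpa using h2
    exact Subtype.ext h3

end Forms

section FormRepresentation

universe u

/-- Take `V` to be the form domain with the form norm, complete because the form is closed. The
sector controls the imaginary part on the diagonal, polarization then bounds the form, and Riesz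
represents it. -/
theorem SesqForm.IsClosedSectorial.exists_formRep {H : Type u} [NormedAddCommGroup H]
    [InnerProductSpace ℂ H] {q : SesqForm H} (hq : q.IsClosedSectorial) :
    ∃ (V : Type u) (_ : NormedAddCommGroup V) (_ : InnerProductSpace ℂ V) (_ : CompleteSpace V)
      (p : V →L[ℂ] H) (N : V →L[ℂ] V), FormRep q p N := by
  obtain ⟨c, θ, h0, h1, hr, hcomp⟩ := hq
  have hb (u : FormSpace q) : c * ‖FormSpace.incl q u‖ ^ 2 ≤ (FormSpace.form q u u).re :=
    (SesqForm.numRange_bounds h0 h1 hr u).1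
  have hb2 (u : FormSpace q) : |(FormSpace.form q u u).im| ≤
      Real.tan θ * ((FormSpace.form q u u).re - c * ‖FormSpace.incl q u‖ ^ 2) :=
    (SesqForm.numRange_bounds h0 h1 hr u).2
  have htan : 0 ≤ Real.tan θ := Real.tan_nonneg_of_nonneg_of_le_pi_div_two h0 h1.le
  let core := FormSpace.core q c hb
  let _ : NormedAddCommGroup (FormSpace q) := core.toNormedAddCommGroup
  let _ : InnerProductSpace ℂ (FormSpace q) := InnerProductSpace.ofCore core.toCore
  have hinner (u v : FormSpace q) : ⟪u, v⟫_ℂ =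
      (FormSpace.form q u v + starRingEnd ℂ (FormSpace.form q v u)) / 2 +
      (1 - c : ℝ) * ⟪FormSpace.incl q u, FormSpace.incl q v⟫_ℂ := rfl
  have hnorm (u : FormSpace q) : ‖u‖ ^ 2 =
      (FormSpace.form q u u).re + (1 - c) * ‖FormSpace.incl q u‖ ^ 2 := by
    rw [← inner_self_eq_norm_sq (𝕜 := ℂ), hinner, Complex.add_conj, Complex.ofReal_mul,
      Complex.ofReal_ofNat, mul_div_cancel_left₀ _ two_ne_zero, inner_self_eq_norm_sq_to_K]
    simp only [RCLike.re_to_complex, Complex.add_re, Complex.re_ofReal_mul]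
    simp only [Complex.coe_algebraMap, ← Complex.ofReal_pow, Complex.ofReal_re]
  have hincl (u : FormSpace q) : ‖FormSpace.incl q u‖ ≤ 1 * ‖u‖ := by
    rw [one_mul]
    refine (pow_le_pow_iff_left₀ (norm_nonneg _) (norm_nonneg _) two_ne_zero).1 ?_
    rw [hnorm]
    linarith [hb u]
  have hform (u : FormSpace q) : ‖FormSpace.form q u u‖ ≤ (1 + |c| + Real.tan θ) * ‖u‖ ^ 2 := by
    have e1 := hnorm u
    have e2 : ‖FormSpace.incl q u‖ ^ 2 ≤ ‖u‖ ^ 2 := by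
      have := hincl u
      rw [one_mul] at this
      gcongr
    have e3 := hb u
    have e4 := hb2 u
    have e5 := abs_le.1 (le_refl |c|)
    have e6 := sq_nonneg ‖FormSpace.incl q u‖
    have e7 : |(FormSpace.form q u u).re| ≤ (1 + |c|) * ‖u‖ ^ 2 := by
      rw [abs_le]
      constructor <;> nlinarith [abs_nonneg c]
    have e8 : |(FormSpace.form q u u).im| ≤ Real.tan θ * ‖u‖ ^ 2 :=
      e4.trans (mul_le_mul_of_nonneg_left (by linarith) htan)
    refine (Complex.norm_le_abs_re_add_abs_im _).trans ?_
    linarith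
  have hform2 (u v : FormSpace q) :
      ‖FormSpace.form q u v‖ ≤ 2 * (1 + |c| + Real.tan θ) * ‖u‖ * ‖v‖ := by
    have := norm_sesq_le (FormSpace.form q) (LinearMap.id (M := FormSpace q))
      Function.injective_id hform u v
    rw [mul_assoc]
    exact this
  let p : FormSpace q →L[ℂ] H := (FormSpace.incl q).mkContinuous 1 hincl
  let S : FormSpace q →L⋆[ℂ] FormSpace q →L[ℂ] ℂ := (FormSpace.form q).mkContinuous₂ _ hform2
  have hcompl : CompleteSpace (FormSpace q) := by
    refine Metric.complete_of_cauchySeq_tendsto fun x hx => ?_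
    have hn (y : FormSpace q) : ‖y‖ ^ 2 = q.normSq c y := hnorm y
    obtain ⟨y, hy⟩ : ∃ y : FormSpace q,
        Tendsto (fun n => q.normSq c (x n - y : FormSpace q)) atTop (𝓝 0) := hcomp x (by
      have h := cauchySeq_iff_tendsto_dist_atTop_0.1 hx
      have h2 := h.pow 2
      rw [zero_pow two_ne_zero] at h2
      refine h2.congr fun n => ?_
      rw [dist_eq_norm]
      exact hn _)
    refine ⟨y, ?_⟩
    rw [tendsto_iff_norm_sub_tendsto_zero]
    have h3 : Tendsto (fun n => ‖x n - y‖ ^ 2) atTop (𝓝 0) := hy.congr fun n => (hn _).symm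
    have h4 := h3.sqrt
    simpa using h4
  -- The Riesz operator acts in the first argument of the inner product, `N` in the second; hence
  -- the adjoint. Coercivity with `E = 1 - c` and `κ = 1` is the definition of the norm.
  refine ⟨FormSpace q, inferInstance, inferInstance, hcompl, p,
    (InnerProductSpace.continuousLinearMapOfBilin S).adjoint, ?_, ?_, ?_, 1 - c, 1, one_pos, ?_⟩
  · exact fun x hx => Subtype.ext hx
  · exact fun u => ⟨fun hu => ⟨⟨u, hu⟩, rfl⟩, by rintro ⟨x, rfl⟩; exact x.2⟩
  · intro x y hx hy
    rw [ContinuousLinearMap.adjoint_inner_right,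
      InnerProductSpace.continuousLinearMapOfBilin_apply]
    rfl
  · intro x
    rw [ContinuousLinearMap.adjoint_inner_right,
      InnerProductSpace.continuousLinearMapOfBilin_apply, one_mul, hnorm x]
    exact le_refl _

/-! ### Lower bounds, resolvent estimates and m-sectoriality. -/

variable {H V : Type*}
variable [NormedAddCommGroup H] [InnerProductSpace ℂ H] [CompleteSpace H]
variable [NormedAddCommGroup V] [InnerProductSpace ℂ V] [CompleteSpace V]

namespace FormRep

variable {q : SesqForm H} {p : V →L[ℂ] H} {N : V →L[ℂ] V}

/-- For `x = L p† f` the bound reads `m ‖p x‖² ≤ Re ⟪p x, f⟫ ≤ ‖p x‖ ‖f‖`. -/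
theorem norm_resolvent_le {L : V →L[ℂ] V} {z : ℂ} {m : ℝ} (hm : 0 < m)
    (h2 : ∀ x, repShift p N z (L x) = x)
    (hb : ∀ x, m * ‖p x‖ ^ 2 ≤ (⟪x, N x⟫_ℂ).re - z.re * ‖p x‖ ^ 2) :
    ‖p ∘L L ∘L p.adjoint‖ ≤ m⁻¹ := by
  refine ContinuousLinearMap.opNorm_le_bound _ (by positivity) fun f => ?_
  set x := L (p.adjoint f) with hx
  change ‖p x‖ ≤ _
  have h3 := hb x
  rw [← re_inner_repShift, hx, h2, ContinuousLinearMap.adjoint_inner_right, ← hx] at h3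
  have h4 : (⟪p x, f⟫_ℂ).re ≤ ‖p x‖ * ‖f‖ :=
    (le_abs_self _).trans ((Complex.abs_re_le_norm _).trans (norm_inner_le_norm _ _))
  rw [inv_mul_eq_div, le_div_iff₀ hm]
  rcases (norm_nonneg (p x)).eq_or_lt with h5 | h5
  · rw [← h5]
    simp
  · refine le_of_mul_le_mul_left (a := ‖p x‖) ?_ h5
    linarith

theorem exists_inverse (h : FormRep q p N) : ∃ (E : ℝ) (L : V →L[ℂ] V),
    (∀ x, L (repShift p N (-E) x) = x) ∧ ∀ x, repShift p N (-E) (L x) = x := by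
  obtain ⟨E, κ, hκ, hc⟩ := h.coercive
  refine ⟨E, exists_inverse_of_coercive hκ fun x => ?_⟩
  simpa using hc x

/-- The operator domain is a core of the form: `p` is injective, and so is `L†` because `L` is onto.
-/
theorem denseRange_comp_adjoint (h : FormRep q p N) {z : ℂ} {L : V →L[ℂ] V}
    (h1 : ∀ x, L (repShift p N z x) = x) : DenseRange (L ∘L p.adjoint) := by
  refine denseRange_of_adjoint_injective _ fun y hy => ?_
  rw [ContinuousLinearMap.adjoint_comp, ContinuousLinearMap.adjoint_adjoint] at hy
  have h3 : L.adjoint y = 0 := h.injective _ hy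
  refine ext_inner_right ℂ fun v => ?_
  rw [← h1 v, ← ContinuousLinearMap.adjoint_inner_left, h3]
  simp

/-- By density of the core, a lower bound of the operator passes to its form; thus the vertex of `T`
also bounds the form. -/
theorem lower_bound (h : FormRep q p N) (hq : Dense (q.domain : Set H)) {m : ℝ}
    (hm : ∀ u : q.operator.domain, m * ‖(u : H)‖ ^ 2 ≤ (⟪(u : H), q.operator u⟫_ℂ).re) (x : V) :
    m * ‖p x‖ ^ 2 ≤ (⟪x, N x⟫_ℂ).re := by
  obtain ⟨E, L, h1, h2⟩ := h.exists_inverse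
  refine (h.denseRange_comp_adjoint h1).induction_on (p := fun x =>
    m * ‖p x‖ ^ 2 ≤ (⟪x, N x⟫_ℂ).re) x (isClosed_le (by fun_prop) (by fun_prop)) fun f => ?_
  set x := (L ∘L p.adjoint) f with hx
  have h3 : N x = p.adjoint (f + (-E : ℂ) • p x) := by
    have : repShift p N (-E) x = p.adjoint f := h2 _
    rw [repShift_apply] at this
    rw [sub_eq_iff_eq_add.1 this, map_add, map_smul]
  have h4 : (p x, f + (-E : ℂ) • p x) ∈ q.operator.graph := by
    rw [SesqForm.operator_graph hq, h.mem_opGraph]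
    exact ⟨x, rfl, h3⟩
  obtain ⟨y, hy1, hy2⟩ := (LinearPMap.mem_graph_iff _).1 h4
  have h5 := hm y
  rw [hy1, hy2] at h5
  rwa [h3, ContinuousLinearMap.adjoint_inner_right]

omit [CompleteSpace H] [CompleteSpace V] in
theorem coercive_of_lower_bound (h : FormRep q p N) {m E : ℝ}
    (hm : ∀ x, m * ‖p x‖ ^ 2 ≤ (⟪x, N x⟫_ℂ).re) (hE : -m < E) :
    ∃ κ : ℝ, 0 < κ ∧ ∀ x, κ * ‖x‖ ^ 2 ≤ (⟪x, N x⟫_ℂ).re + E * ‖p x‖ ^ 2 := by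
  obtain ⟨E', κ, hκ, hc⟩ := h.coercive
  have hd : 0 < E + m := by linarith
  -- A convex combination of coercivity at `E'` and the lower bound `m`, with weights proportional
  -- to `E + m` and `|E' - E|`.
  refine ⟨κ * (E + m) / (E + m + |E' - E|), by positivity, fun x => ?_⟩
  have h1 := hc x
  have h2 := hm x
  have h3 := le_abs_self (E' - E)
  have h4 := sq_nonneg ‖p x‖
  rw [div_mul_eq_mul_div, div_le_iff₀ (by positivity)]
  nlinarith [mul_nonneg (abs_nonneg (E' - E)) (sub_nonneg.2 h2), mul_nonneg hd.le (sub_nonneg.2 h1),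
    mul_nonneg hd.le (mul_nonneg (sub_nonneg.2 h3) h4)]

theorem isMSectorial (h : FormRep q p N) (hq : Dense (q.domain : Set H)) :
    ∃ γ θ : ℝ, IsMSectorial q.operator γ θ := by
  obtain ⟨c, θ, h0, h1, hr, -⟩ := h.isClosedSectorial
  obtain ⟨E, κ, hκ, hc⟩ := h.coercive
  refine ⟨c, θ, h0, h1, ⟨E, fun ζ hζ => ?_⟩, ?_⟩
  · have hre : (-ζ - (E : ℂ)).re = -ζ.re - E := by simp
    obtain ⟨L, hL1, hL2⟩ := exists_inverse_of_coercive (p := p) (N := N) (z := -ζ - (E : ℂ)) hκ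
      fun x => by
        rw [hre]
        nlinarith [hc x, sq_nonneg ‖p x‖]
    have hR := IsResolventAt.shift_iff.2 (h.isResolventAt hq hL1 hL2)
    refine ⟨⟨_, hR⟩, ?_⟩
    rw [hR.resolv_eq]
    refine norm_resolvent_le hζ hL2 fun x => ?_
    rw [hre]
    nlinarith [hc x, mul_nonneg hκ.le (sq_nonneg ‖x‖)]
  · rintro ζ ⟨u, hu, rfl⟩
    have h3 := q.operator.mem_graph u
    rw [SesqForm.operator_graph hq] at h3
    obtain ⟨hu', h4⟩ := h3
    exact hr ⟨⟨u, hu'⟩, hu, (h4 ⟨u, hu'⟩).symm⟩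

end FormRep

end FormRepresentation

section SectorialForm

variable {H : Type*} [NormedAddCommGroup H] [InnerProductSpace ℂ H] [CompleteSpace H]

/-! ### The form of an m-sectorial operator -/

theorem exists_sqrt_re (a : H →L[ℂ] H) (hre : ∀ f, 0 ≤ (⟪f, a f⟫_ℂ).re) :
    ∃ p : H →L[ℂ] H, p.adjoint = p ∧ ∀ f, ‖p f‖ ^ 2 = (⟪f, a f⟫_ℂ).re := by
  let g : H →L[ℂ] H := (1 / 2 : ℝ) • (a + a.adjoint)
  have hg (f : H) : (⟪f, g f⟫_ℂ).re = (⟪f, a f⟫_ℂ).re := by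
    have e : g f = ((1 / 2 : ℝ) : ℂ) • (a f + a.adjoint f) := rfl
    have e2 : (⟪f, a.adjoint f⟫_ℂ).re = (⟪f, a f⟫_ℂ).re := by
      rw [ContinuousLinearMap.adjoint_inner_right, ← inner_conj_symm, Complex.conj_re]
    rw [e, inner_smul_right, inner_add_right, Complex.re_ofReal_mul, Complex.add_re, e2]
    ring
  have hsa : IsSelfAdjoint g :=
    IsSelfAdjoint.smul (IsSelfAdjoint.all _) (IsSelfAdjoint.add_star_self a)
  have hpos : 0 ≤ g := by
    rw [ContinuousLinearMap.nonneg_iff_isPositive, ContinuousLinearMap.isPositive_def']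
    refine ⟨hsa, fun x => ?_⟩
    rw [ContinuousLinearMap.reApplyInnerSelf_apply, inner_re_symm]
    exact (hre x).trans_eq (hg x).symm
  have hp : IsSelfAdjoint (CFC.sqrt g) := (CFC.sqrt_nonneg g).isSelfAdjoint
  have hp' : (CFC.sqrt g).adjoint = CFC.sqrt g := hp
  refine ⟨CFC.sqrt g, hp', fun f => ?_⟩
  have hmul : (CFC.sqrt g) (CFC.sqrt g f) = g f :=
    congrArg (fun A : H →L[ℂ] H => A f) (CFC.sqrt_mul_sqrt_self g hpos)
  rw [← hg f, ← hmul, ← ContinuousLinearMap.adjoint_inner_left, hp', inner_self_eq_norm_sq_to_K]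
  simp [← Complex.ofReal_pow]

/-- A bounded injective sectorial operator `a` factors as `p M p` with `p` the square root of its
real part and `Re M = 1`. -/
theorem exists_factorization (a : H →L[ℂ] H) {δ t : ℝ} (hδ : 0 < δ)
    (hinj : ∀ f, a f = 0 → f = 0) (hre : ∀ f, δ * ‖a f‖ ^ 2 ≤ (⟪f, a f⟫_ℂ).re)
    (him : ∀ f, |(⟪f, a f⟫_ℂ).im| ≤ t * (⟪f, a f⟫_ℂ).re) :
    ∃ p M : H →L[ℂ] H, (∀ x, p x = 0 → x = 0) ∧ p.adjoint = p ∧ (∀ x, p (M (p x)) = a x) ∧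
      ∀ y, (⟪y, M y⟫_ℂ).re = ‖y‖ ^ 2 := by
  obtain ⟨p, hp, hpa⟩ := exists_sqrt_re a fun f => le_trans (by positivity) (hre f)
  have hpinj (x : H) (hx : p x = 0) : x = 0 := by
    refine hinj x ?_
    have h1 := hre x
    rw [← hpa, hx, norm_zero, zero_pow two_ne_zero] at h1
    have h2 : ‖a x‖ ^ 2 = 0 := le_antisymm (nonpos_of_mul_nonpos_right h1 hδ) (by positivity)
    simpa using h2
  have hpd : DenseRange p := denseRange_of_adjoint_injective p (by rwa [hp])
  let s : H →ₗ⋆[ℂ] H →ₗ[ℂ] ℂ := (innerₛₗ ℂ).compl₂ (a : H →ₗ[ℂ] H)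
  have hs (x y : H) : ‖⟪x, a y⟫_ℂ‖ ≤ 2 * (1 + t) * (‖p x‖ * ‖p y‖) := by
    refine norm_sesq_le s (p : H →ₗ[ℂ] H)
      ((injective_iff_map_eq_zero (p : H →ₗ[ℂ] H)).2 hpinj) (fun u => ?_) x y
    change ‖⟪u, a u⟫_ℂ‖ ≤ (1 + t) * ‖p u‖ ^ 2
    have h1 := him u
    have h2 := hpa u
    rw [← h2] at h1
    refine (Complex.norm_le_abs_re_add_abs_im _).trans ?_
    rw [← h2, abs_of_nonneg (by positivity)]
    linarith
  -- The sign of `t` is not assumed; if `1 + t < 0`, the estimate `hs` forces `H` to be trivial.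
  by_cases ht : 0 ≤ 1 + t
  swap
  · have hzero (x : H) : x = 0 := by
      by_contra hx
      have h1 := hs x x
      have h2 : 0 < ‖p x‖ := norm_pos_iff.2 fun h => hx (hpinj x h)
      nlinarith [norm_nonneg ⟪x, a x⟫_ℂ, mul_pos h2 h2]
    exact ⟨p, p, hpinj, hp, fun x => (hzero _).trans (hzero _).symm, fun y => by simp [hzero y]⟩
  have hQ (y : H) : ‖a y‖ ≤ 2 * (1 + t) * ‖p‖ * ‖p y‖ := by
    rcases eq_or_ne (a y) 0 with h0 | h0
    · rw [h0, norm_zero]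
      positivity
    have h1 := hs (a y) y
    rw [inner_self_eq_norm_sq_to_K, norm_pow, RCLike.norm_ofReal, abs_norm] at h1
    have h2 := p.le_opNorm (a y)
    have h3 : 0 < ‖a y‖ := norm_pos_iff.2 h0
    refine le_of_mul_le_mul_left (a := ‖a y‖) ?_ h3
    calc ‖a y‖ * ‖a y‖ = ‖a y‖ ^ 2 := (sq _).symm
      _ ≤ 2 * (1 + t) * (‖p (a y)‖ * ‖p y‖) := h1
      _ ≤ 2 * (1 + t) * ((‖p‖ * ‖a y‖) * ‖p y‖) := by gcongr
      _ = _ := by ring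
  -- Divide by `p` twice: `a = Q p`, then `Q† = N p`, hence `a = p N† p`. Both quotients are bounded
  -- by `hs` and extend from the dense range of `p`.
  let Q : H →L[ℂ] H := (a : H →ₗ[ℂ] H).extendOfNorm (p : H →ₗ[ℂ] H)
  have hQp (x : H) : Q (p x) = a x :=
    LinearMap.extendOfNorm_eq (f := (a : H →ₗ[ℂ] H)) (e := (p : H →ₗ[ℂ] H)) hpd ⟨_, hQ⟩ x
  have hQa (x z : H) : ‖⟪Q.adjoint x, z⟫_ℂ‖ ≤ 2 * (1 + t) * ‖p x‖ * ‖z‖ := by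
    refine hpd.induction_on (p := fun z => ‖⟪Q.adjoint x, z⟫_ℂ‖ ≤ 2 * (1 + t) * ‖p x‖ * ‖z‖) z
      (isClosed_le (by fun_prop) (by fun_prop)) fun y => ?_
    rw [ContinuousLinearMap.adjoint_inner_left, hQp, mul_assoc]
    exact hs x y
  have hQn (x : H) : ‖Q.adjoint x‖ ≤ 2 * (1 + t) * ‖p x‖ := by
    rcases eq_or_ne (Q.adjoint x) 0 with h0 | h0
    · rw [h0, norm_zero]
      positivity
    have h1 := hQa x (Q.adjoint x)
    rw [inner_self_eq_norm_sq_to_K, norm_pow, RCLike.norm_ofReal, abs_norm, sq] at h1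
    exact le_of_mul_le_mul_right h1 (norm_pos_iff.2 h0)
  let N : H →L[ℂ] H := (Q.adjoint : H →ₗ[ℂ] H).extendOfNorm (p : H →ₗ[ℂ] H)
  have hNp (x : H) : N (p x) = Q.adjoint x :=
    LinearMap.extendOfNorm_eq (f := (Q.adjoint : H →ₗ[ℂ] H)) (e := (p : H →ₗ[ℂ] H)) hpd ⟨_, hQn⟩ x
  have hfac (x : H) : p (N.adjoint (p x)) = a x := by
    refine ext_inner_left ℂ fun w => ?_
    rw [← ContinuousLinearMap.adjoint_inner_left, hp, ContinuousLinearMap.adjoint_inner_right, hNp,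
      ContinuousLinearMap.adjoint_inner_left, hQp]
  refine ⟨p, N.adjoint, hpinj, hp, hfac, fun y => ?_⟩
  refine hpd.induction_on (p := fun y => (⟪y, N.adjoint y⟫_ℂ).re = ‖y‖ ^ 2) y
    (isClosed_eq (by fun_prop) (by fun_prop)) fun x => ?_
  rw [hpa, ← hfac, ← ContinuousLinearMap.adjoint_inner_left p, hp]

namespace IsMSectorial

variable {T : H →ₗ.[ℂ] H} {γ θ : ℝ}

omit [CompleteSpace H] in
theorem exists_resolvent (hT : IsMSectorial T γ θ) :
    ∃ E : ℝ, -γ < E ∧ ∃ R, IsResolventAt T (-(E : ℂ)) R := by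
  obtain ⟨α, hα⟩ := hT.quasi
  let E : ℝ := max α (-γ) + 1
  have h1 : α < E := lt_of_le_of_lt (le_max_left _ _) (lt_add_one _)
  obtain ⟨⟨R, hR⟩, -⟩ := hα ((E - α : ℝ) : ℂ) (by simpa using h1)
  refine ⟨E, lt_of_le_of_lt (le_max_right _ _) (lt_add_one _), R, ?_⟩
  have := IsResolventAt.shift_iff.1 hR
  convert this using 1
  push_cast
  ring

omit [CompleteSpace H] in
theorem resolvent_bounds (hT : IsMSectorial T γ θ) {E : ℝ} {R : H →L[ℂ] H} (hE : -γ < E)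
    (hR : IsResolventAt T (-(E : ℂ)) R) (f : H) :
    (E + γ) * ‖R f‖ ^ 2 ≤ (⟪f, R f⟫_ℂ).re ∧
      |(⟪f, R f⟫_ℂ).im| ≤ Real.tan θ * (⟪f, R f⟫_ℂ).re := by
  obtain ⟨hd, he⟩ := hR.1 f
  obtain ⟨h1, h2⟩ := numRange_bounds hT.angle_nonneg hT.angle_lt hT.range_subset ⟨R f, hd⟩
  have h3 : T ⟨R f, hd⟩ = f - (E : ℂ) • R f := by
    rw [sub_eq_iff_eq_add.1 he]
    module
  have h4 : ⟪R f, T ⟨R f, hd⟩⟫_ℂ = ⟪R f, f⟫_ℂ - ((E * ‖R f‖ ^ 2 : ℝ) : ℂ) := by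
    rw [h3, inner_sub_right, inner_smul_right, inner_self_eq_norm_sq_to_K]
    simp
  simp only [h4, Complex.sub_re, Complex.sub_im, Complex.ofReal_re, Complex.ofReal_im,
    sub_zero] at h1 h2
  have htan : 0 ≤ Real.tan θ :=
    Real.tan_nonneg_of_nonneg_of_le_pi_div_two hT.angle_nonneg hT.angle_lt.le
  rw [← inner_conj_symm, Complex.conj_re, Complex.conj_im, abs_neg]
  refine ⟨by linarith, h2.trans (mul_le_mul_of_nonneg_left ?_ htan)⟩
  nlinarith [sq_nonneg ‖R f‖]

theorem dense_domain (hT : IsMSectorial T γ θ) : Dense (T.domain : Set H) := by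
  obtain ⟨E, hE, R, hR⟩ := hT.exists_resolvent
  have h1 : DenseRange R := by
    refine denseRange_of_adjoint_injective R fun y hy => hR.injective ?_
    have h2 := (hT.resolvent_bounds hE hR y).1
    rw [← ContinuousLinearMap.adjoint_inner_left, hy, inner_zero_left, Complex.zero_re] at h2
    have h3 : ‖R y‖ ^ 2 = 0 :=
      le_antisymm (nonpos_of_mul_nonpos_right h2 (by linarith)) (by positivity)
    simpa using h3
  refine h1.mono ?_
  rintro _ ⟨f, rfl⟩
  exact hR.mem_domain_iff.2 ⟨f, rfl⟩

/-- From `(T + E)⁻¹ = p M p` one reads off the form of `T` on the range of `p`: it is `⟪x, M⁻¹ y⟫ -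
E ⟪p x, p y⟫`, represented with `V = H`. -/
theorem exists_form (hT : IsMSectorial T γ θ) :
    ∃ q : SesqForm H, q.IsClosedSectorial ∧ q.operator = T := by
  obtain ⟨E, hE, a, ha⟩ := hT.exists_resolvent
  have hb := hT.resolvent_bounds hE ha
  obtain ⟨p, M, hpinj, hp, hfac, hM⟩ := exists_factorization a (δ := E + γ) (by linarith)
    (fun f hf => ha.injective hf) (fun f => (hb f).1) (fun f => (hb f).2)
  obtain ⟨U, hU⟩ := isUnit_of_le_re_inner M one_pos fun u => by rw [one_mul, hM]
  have hU1 (x : H) : M (U⁻¹.val x) = x := by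
    rw [← hU]
    exact congrArg (fun A : H →L[ℂ] H => A x) U.mul_inv
  have hU2 (x : H) : U⁻¹.val (M x) = x := by
    rw [← hU]
    exact congrArg (fun A : H →L[ℂ] H => A x) U.inv_mul
  let N : H →L[ℂ] H := U⁻¹.val - (E : ℂ) • (p.adjoint ∘L p)
  have hN (x : H) : repShift p N (-(E : ℂ)) x = U⁻¹.val x := by
    change U⁻¹.val x - (E : ℂ) • p.adjoint (p x) - (-(E : ℂ)) • p.adjoint (p x) = _
    module
  -- Since `Re M = 1`, the shifted real part equals `‖M⁻¹ x‖²`, and `‖x‖ ≤ ‖M‖ ‖M⁻¹ x‖`. The added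
  -- `1` avoids dividing by zero.
  have hco : ∀ x, (‖M‖ ^ 2 + 1)⁻¹ * ‖x‖ ^ 2 ≤ (⟪x, N x⟫_ℂ).re + E * ‖p x‖ ^ 2 := by
    intro x
    have h1 := re_inner_repShift p N (-(E : ℂ)) x
    rw [hN, Complex.neg_re, Complex.ofReal_re, neg_mul, sub_neg_eq_add] at h1
    rw [← h1, ← inner_conj_symm, Complex.conj_re]
    have h2 := hM (U⁻¹.val x)
    rw [hU1] at h2
    rw [h2, inv_mul_le_iff₀ (by positivity)]
    have h3 := M.le_opNorm (U⁻¹.val x)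
    rw [hU1] at h3
    calc ‖x‖ ^ 2 ≤ (‖M‖ * ‖U⁻¹.val x‖) ^ 2 := by gcongr
      _ ≤ _ := by nlinarith [sq_nonneg ‖U⁻¹.val x‖]
  obtain ⟨q, hq⟩ := FormRep.of_range p hpinj N ⟨E, _, by positivity, hco⟩
  have hqd : Dense (q.domain : Set H) := by
    have hpd : DenseRange p := denseRange_of_adjoint_injective p (by rwa [hp])
    refine hpd.mono ?_
    rintro _ ⟨x, rfl⟩
    exact hq.mem x
  refine ⟨q, hq.isClosedSectorial, ?_⟩
  have hres := hq.isResolventAt hqd (z := -(E : ℂ)) (L := M) (fun x => by rw [hN, hU1])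
    (fun x => by rw [hN, hU2])
  have : p ∘L M ∘L p.adjoint = a := by
    ext x
    rw [hp]
    exact hfac x
  rw [this] at hres
  exact hres.operator_unique ha

theorem formOf_spec (hT : IsMSectorial T γ θ) :
    (formOf T).IsClosedSectorial ∧ (formOf T).operator = T := by
  rw [formOf, dif_pos hT.exists_form]
  exact hT.exists_form.choose_spec

theorem dense_formOf (hT : IsMSectorial T γ θ) : Dense ((formOf T).domain : Set H) := by
  refine hT.dense_domain.mono fun x hx => ?_
  refine (formOf T).operator_domain_le ?_
  rwa [hT.formOf_spec.2]

end IsMSectorial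

universe u

theorem IsMSectorial.exists_formRep {H : Type u} [NormedAddCommGroup H] [InnerProductSpace ℂ H]
    [CompleteSpace H] {T : H →ₗ.[ℂ] H} {γ θ : ℝ} (hT : IsMSectorial T γ θ) :
    ∃ (V : Type u) (_ : NormedAddCommGroup V) (_ : InnerProductSpace ℂ V) (_ : CompleteSpace V)
      (p : V →L[ℂ] H) (N : V →L[ℂ] V), FormRep (formOf T) p N ∧
        ∀ x, γ * ‖p x‖ ^ 2 ≤ (⟪x, N x⟫_ℂ).re := by
  obtain ⟨V, i1, i2, i3, p, N, h⟩ := hT.formOf_spec.1.exists_formRep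
  refine ⟨V, i1, i2, i3, p, N, h, h.lower_bound hT.dense_formOf ?_⟩
  rw [hT.formOf_spec.2]
  exact fun u => (numRange_bounds hT.angle_nonneg hT.angle_lt hT.range_subset u).1

end SectorialForm

section SquareRoot

variable {H V : Type*}
variable [NormedAddCommGroup H] [InnerProductSpace ℂ H] [CompleteSpace H]
variable [NormedAddCommGroup V] [InnerProductSpace ℂ V] [CompleteSpace V]

/-! ### The square root of an m-sectorial operator -/

namespace IsMSectorial

variable {T : H →ₗ.[ℂ] H} {γ θ : ℝ}

/-- Quasi-accretivity gives resolvents only far to the left; the lower bound `γ` of the form extends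
them to every `E > -γ`. -/
theorem resolv_spec (hT : IsMSectorial T γ θ) {E : ℝ} (hE : -γ < E) :
    IsResolventAt T (-(E : ℂ)) (resolv T (-(E : ℂ))) ∧ ‖resolv T (-(E : ℂ))‖ ≤ (E + γ)⁻¹ := by
  obtain ⟨V, _, _, _, p, N, h, hlow⟩ := hT.exists_formRep
  obtain ⟨κ, hκ, hc⟩ := h.coercive_of_lower_bound hlow hE
  obtain ⟨L, h1, h2⟩ := FormRep.exists_inverse_of_coercive (p := p) (N := N) (z := -(E : ℂ)) hκ
    fun x => by simpa using hc x
  have hR := h.isResolventAt hT.dense_formOf h1 h2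
  rw [hT.formOf_spec.2] at hR
  rw [hR.resolv_eq]
  refine ⟨hR, FormRep.norm_resolvent_le (by linarith) h2 fun x => ?_⟩
  rw [Complex.neg_re, Complex.ofReal_re]
  linarith [hlow x]

theorem isPseudoResolvent (hT : IsMSectorial T γ θ) :
    IsPseudoResolvent fun x : ℝ => resolv T (-((x - γ : ℝ) : ℂ)) where
  norm_le x hx := by
    have := (hT.resolv_spec (E := x - γ) (by linarith)).2
    rwa [sub_add_cancel] at this
  identity x y hx hy := by
    have h1 := (hT.resolv_spec (E := x - γ) (by linarith)).1
    have h2 := (hT.resolv_spec (E := y - γ) (by linarith)).1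
    rw [h1.sub_eq h2, ← Complex.coe_smul]
    congr 1
    push_cast
    ring

theorem invSqrt_eq (T : H →ₗ.[ℂ] H) (γ E : ℝ) :
    invSqrt T E = (Real.pi)⁻¹ •
      sqrtIntegral (fun x : ℝ => resolv T (-((x - γ : ℝ) : ℂ))) (E + γ) := by
  simp only [invSqrt, sqrtIntegral, add_right_comm E γ, add_sub_cancel_right]

theorem invSqrt_mul_self (hT : IsMSectorial T γ θ) {E : ℝ} (hE : -γ < E) :
    invSqrt T E * invSqrt T E = resolv T (-(E : ℂ)) := by
  have h := hT.isPseudoResolvent.sqrtIntegral_mul_self (e := E + γ) (by linarith)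
  rw [add_sub_cancel_right] at h
  rw [invSqrt_eq T γ, smul_mul_smul_comm, h, smul_smul]
  have : (Real.pi)⁻¹ * (Real.pi)⁻¹ * Real.pi ^ 2 = 1 := by
    field_simp
  rw [this, one_smul]

theorem invSqrt_adjoint (hT : IsMSectorial T γ θ) {E : ℝ} (hE : -γ < E) :
    invSqrt T† E = (invSqrt T E).adjoint := by
  have hres (l : ℝ) (hl : 0 < l) : resolv T† (-((E + l : ℝ) : ℂ)) =
      (resolv T (-((E + l : ℝ) : ℂ))).adjoint := by
    have h := ((hT.resolv_spec (E := E + l) (by linarith)).1.adjoint hT.dense_domain)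
    rw [map_neg, Complex.conj_ofReal] at h
    exact h.resolv_eq
  let S : (H →L[ℂ] H) →L[ℝ] (H →L[ℂ] H) := (starL' ℝ : (H →L[ℂ] H) ≃L[ℝ] (H →L[ℂ] H))
  have hint : IntegrableOn
      (fun l : ℝ => (l ^ (-(1 / 2) : ℝ)) • resolv T (-((E + l : ℝ) : ℂ))) (Set.Ioi 0) := by
    have h := hT.isPseudoResolvent.integrableOn (E := E + γ) (by linarith)
    simpa only [add_right_comm E γ, add_sub_cancel_right] using h
  have h1 := S.integral_comp_comm hint
  have hS (A : H →L[ℂ] H) : S A = A.adjoint := rfl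
  have h2 : (invSqrt T E).adjoint = S (invSqrt T E) := rfl
  rw [h2, invSqrt, invSqrt, map_smul, ← h1]
  congr 1
  refine setIntegral_congr_fun measurableSet_Ioi fun l hl => ?_
  change _ • resolv T† _ = S (_ • _)
  rw [S.map_smul, hS, hres l hl]

end IsMSectorial

omit [CompleteSpace H] in
theorem mem_sqrtDomain {T : H →ₗ.[ℂ] H} {E : ℝ} {u : H} :
    u ∈ sqrtDomain T E ↔ ∃ f, invSqrt T E f = u := by
  rw [sqrtDomain, shiftSqrt, LinearPMap.inverse_domain]
  constructor
  · rintro ⟨f, rfl⟩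
    exact ⟨f, rfl⟩
  · rintro ⟨f, rfl⟩
    exact ⟨⟨f, trivial⟩, rfl⟩

/-- Douglas' factorization for an injective operator. -/
theorem exists_factor_of_range_le (S J : H →L[ℂ] H) (hS : ∀ x, S x = 0 → x = 0)
    (h : ∀ f, ∃ g, S g = J f) : ∃ C : H →L[ℂ] H, ∀ f, S (C f) = J f := by
  have hinj : Function.Injective (S : H →ₗ[ℂ] H) :=
    (injective_iff_map_eq_zero (S : H →ₗ[ℂ] H)).2 hS
  let e := LinearEquiv.ofInjective (S : H →ₗ[ℂ] H) hinj
  let C₀ : H →ₗ[ℂ] H :=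
    (e.symm : _ →ₗ[ℂ] H).comp ((J : H →ₗ[ℂ] H).codRestrict (LinearMap.range (S : H →ₗ[ℂ] H)) h)
  have hC (f : H) : S (C₀ f) = J f :=
    congrArg Subtype.val (e.apply_symm_apply ⟨J f, h f⟩)
  refine ⟨ContinuousLinearMap.ofSeqClosedGraph (g := C₀) fun u x y hu hy => ?_, hC⟩
  apply hinj
  change S y = S (C₀ x)
  rw [hC]
  refine tendsto_nhds_unique ((S.continuous.tendsto y).comp hy) ?_
  refine ((J.continuous.tendsto x).comp hu).congr fun n => ?_
  exact (hC (u n)).symm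

/-- If `J` is a square root of `p S⁻¹ p†` with `S` coercive and `J`, `J†` have the same range, then
this is the range of `p`. -/
theorem range_eq_of_sqrt {p : V →L[ℂ] H} {S L : V →L[ℂ] V} {κ : ℝ} (hκ : 0 < κ)
    (hc : ∀ x, κ * ‖x‖ ^ 2 ≤ (⟪x, S x⟫_ℂ).re) (hL : ∀ x, S (L x) = x) {J : H →L[ℂ] H}
    (hJ : ∀ f, J (J f) = p (L (p.adjoint f))) (hJinj : ∀ f, J.adjoint f = 0 → f = 0)
    (hr : ∀ u, (∃ f, J f = u) ↔ ∃ f, J.adjoint f = u) (u : H) :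
    (∃ x, p x = u) ↔ ∃ f, J f = u := by
  obtain ⟨C, hC⟩ := exists_factor_of_range_le J.adjoint J hJinj fun f => (hr _).1 ⟨f, rfl⟩
  have hd : DenseRange J := denseRange_of_adjoint_injective J hJinj
  -- Writing `J = J† C` gives `κ ‖L p† g‖² ≤ Re ⟪J J g, g⟫ = Re ⟪C J g, J g⟫`, so `L p†` factors
  -- through `J` as `X J`.
  have hbd (g : H) : ‖(L ∘L p.adjoint) g‖ ≤ √(‖C‖ / κ) * ‖J g‖ := by
    have h1 := hc (L (p.adjoint g))
    rw [hL, ContinuousLinearMap.adjoint_inner_right, ← hJ] at h1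
    have h2 : ⟪J (J g), g⟫_ℂ = ⟪C (J g), J g⟫_ℂ := by
      rw [← hC, ContinuousLinearMap.adjoint_inner_left]
    have h3 : (⟪C (J g), J g⟫_ℂ).re ≤ ‖C‖ * ‖J g‖ ^ 2 := by
      refine (le_abs_self _).trans ((Complex.abs_re_le_norm _).trans
        ((norm_inner_le_norm _ _).trans ?_))
      calc ‖C (J g)‖ * ‖J g‖ ≤ (‖C‖ * ‖J g‖) * ‖J g‖ := by gcongr; exact C.le_opNorm _
        _ = _ := by ring
    rw [h2] at h1
    change ‖L (p.adjoint g)‖ ≤ _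
    refine (pow_le_pow_iff_left₀ (norm_nonneg _) (by positivity) two_ne_zero).1 ?_
    rw [mul_pow, Real.sq_sqrt (by positivity), div_mul_eq_mul_div, le_div_iff₀ hκ, mul_comm]
    exact h1.trans h3
  let X : H →L[ℂ] V := ((L ∘L p.adjoint : H →L[ℂ] V) : H →ₗ[ℂ] V).extendOfNorm (J : H →ₗ[ℂ] H)
  have hX (g : H) : X (J g) = L (p.adjoint g) :=
    LinearMap.extendOfNorm_eq (f := ((L ∘L p.adjoint : H →L[ℂ] V) : H →ₗ[ℂ] V))
      (e := (J : H →ₗ[ℂ] H)) hd ⟨_, hbd⟩ g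
  have hpX (f : H) : p (X f) = J f := by
    refine hd.induction_on (p := fun f => p (X f) = J f) f
      (isClosed_eq (by fun_prop) (by fun_prop)) fun g => ?_
    rw [hX, hJ]
  constructor
  · rintro ⟨y, rfl⟩
    -- The adjoint of `S X J = p†` is `p = J† X† S†`, so the range of `p` lies in that of `J†`.
    refine (hr _).2 ⟨X.adjoint (S.adjoint y), ext_inner_right ℂ fun g => ?_⟩
    rw [ContinuousLinearMap.adjoint_inner_left, ContinuousLinearMap.adjoint_inner_left,
      ContinuousLinearMap.adjoint_inner_left, hX, hL, ContinuousLinearMap.adjoint_inner_right]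
  · rintro ⟨f, rfl⟩
    exact ⟨X f, hpX f⟩

/-- **Kato's theorem**: if `T^(1/2)` and `(T†)^(1/2)` have the same domain, it is the form
domain. -/
theorem IsMSectorial.formOf_domain_eq {T : H →ₗ.[ℂ] H} {γ θ : ℝ} (hT : IsMSectorial T γ θ) {E : ℝ}
    (hE : -γ < E) (hsqrt : sqrtDomain T E = sqrtDomain T† E) :
    (formOf T).domain = sqrtDomain T E := by
  obtain ⟨V, _, _, _, p, N, h, hlow⟩ := hT.exists_formRep
  obtain ⟨κ, hκ, hc⟩ := h.coercive_of_lower_bound hlow hE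
  have hc' (x : V) : κ * ‖x‖ ^ 2 ≤ (⟪x, N x⟫_ℂ).re - (-(E : ℂ)).re * ‖p x‖ ^ 2 := by
    simpa using hc x
  obtain ⟨L, h1, h2⟩ := FormRep.exists_inverse_of_coercive hκ hc'
  have hR := h.isResolventAt hT.dense_formOf h1 h2
  rw [hT.formOf_spec.2] at hR
  have hJJ := hT.invSqrt_mul_self hE
  rw [hR.resolv_eq] at hJJ
  ext u
  rw [h.mem_domain, mem_sqrtDomain]
  refine range_eq_of_sqrt (S := repShift p N (-(E : ℂ))) (L := L) hκ
    (fun x => by rw [re_inner_repShift]; exact hc' x) h2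
    (fun f => congrArg (fun A : H →L[ℂ] H => A f) hJJ) (fun f hf => ?_) (fun u => ?_) u
  · refine (hR.adjoint hT.dense_domain).injective (f := f) ?_
    rw [← hJJ]
    refine ext_inner_right ℂ fun g => ?_
    rw [ContinuousLinearMap.adjoint_inner_left]
    change ⟪f, invSqrt T E (invSqrt T E g)⟫_ℂ = _
    rw [← ContinuousLinearMap.adjoint_inner_left, hf, inner_zero_left, inner_zero_left]
  · rw [← hT.invSqrt_adjoint hE, ← mem_sqrtDomain, ← mem_sqrtDomain, hsqrt]

end SquareRoot

section KatoFormula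

variable {H F V : Type*}
variable [NormedAddCommGroup H] [InnerProductSpace ℂ H]
variable [NormedAddCommGroup F] [InnerProductSpace ℂ F]
variable [NormedAddCommGroup V] [InnerProductSpace ℂ V]

/-! ### Form-bounded factors and Kato's formula -/

theorem exists_bounded_comp (A : H →ₗ.[ℂ] F) (p : V →L[ℂ] H) (N : V →L[ℂ] V)
    (hd : ∀ x, p x ∈ A.domain) {a b : ℝ} (ha : 0 ≤ a) (hb : 0 ≤ b)
    (h : ∀ x, ‖A ⟨p x, hd x⟩‖ ^ 2 ≤ a * (⟪x, N x⟫_ℂ).re + b * ‖p x‖ ^ 2) :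
    ∃ α : V →L[ℂ] F, ∀ x, α x = A ⟨p x, hd x⟩ := by
  let α₀ : V →ₗ[ℂ] F := A.toFun.comp ((p : V →ₗ[ℂ] H).codRestrict A.domain hd)
  refine ⟨α₀.mkContinuous (√(a * ‖N‖ + b * ‖p‖ ^ 2)) fun x => ?_, fun x => rfl⟩
  refine (pow_le_pow_iff_left₀ (norm_nonneg _) (by positivity) two_ne_zero).1 ?_
  rw [mul_pow, Real.sq_sqrt (by positivity)]
  refine (h x).trans ?_
  have h1 := FormRep.re_le (N := N) x
  have h2 : ‖p x‖ ^ 2 ≤ ‖p‖ ^ 2 * ‖x‖ ^ 2 := by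
    rw [← mul_pow]
    gcongr
    exact p.le_opNorm x
  rw [add_mul, mul_assoc, mul_assoc]
  gcongr

variable [CompleteSpace H] [CompleteSpace F] [CompleteSpace V]

/-- Replaces the unbounded `B†` by the bounded `β†` wherever `p†` precedes it. -/
theorem adjoint_comp_adjoint {B : H →ₗ.[ℂ] F} (hB : Dense (B.domain : Set H)) {p : V →L[ℂ] H}
    (hd : ∀ x, p x ∈ B.domain) {β : V →L[ℂ] F} (hβ : ∀ x, β x = B ⟨p x, hd x⟩) (y : B†.domain) :
    p.adjoint (B† y) = β.adjoint y := by
  refine ext_inner_right ℂ fun x => ?_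
  rw [ContinuousLinearMap.adjoint_inner_left, ContinuousLinearMap.adjoint_inner_left, hβ]
  exact LinearPMap.adjoint_isFormalAdjoint hB y ⟨p x, hd x⟩

omit [CompleteSpace F] [CompleteSpace V] in
/-- The Woodbury identity: inverting `S + β† α` in terms of `S⁻¹` and `(1 + α S⁻¹ β†)⁻¹`. -/
theorem woodbury {S L : V →L[ℂ] V} {α : V →L[ℂ] F} {δ : F →L[ℂ] V} {W : F →L[ℂ] F}
    (h1 : ∀ x, L (S x) = x) (h2 : ∀ x, S (L x) = x)
    (hW1 : ∀ y, W (y + α (L (δ y))) = y) (hW2 : ∀ y, W y + α (L (δ (W y))) = y) :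
    (∀ x, (L - L ∘L δ ∘L W ∘L α ∘L L) ((S + δ ∘L α) x) = x) ∧
      ∀ x, (S + δ ∘L α) ((L - L ∘L δ ∘L W ∘L α ∘L L) x) = x := by
  constructor
  · intro x
    change L (S x + δ (α x)) - L (δ (W (α (L (S x + δ (α x)))))) = x
    have e : α (L (S x + δ (α x))) = α x + α (L (δ (α x))) := by rw [map_add, h1, map_add]
    rw [e, hW1, map_add, h1, add_sub_cancel_right]
  · intro x
    change S (L x - L (δ (W (α (L x))))) + δ (α (L x - L (δ (W (α (L x)))))) = x
    have e := congrArg δ (hW2 (α (L x)))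
    rw [map_add] at e
    simp only [map_sub, h2]
    linear_combination (norm := module) (-1 : ℂ) • e

section Products

variable {T₀ : H →ₗ.[ℂ] H} {A B : H →ₗ.[ℂ] F} {p : V →L[ℂ] H} {α β : V →L[ℂ] F} {L : V →L[ℂ] V}
  {z : ℂ}

omit [CompleteSpace F] in
theorem isBoundedClosure_resA (hdA : ∀ x, p x ∈ A.domain) (hα : ∀ x, α x = A ⟨p x, hdA x⟩)
    (hR : resolv T₀ z = p ∘L L ∘L p.adjoint) :
    IsBoundedClosure (resA T₀ A z) (α ∘L L ∘L p.adjoint) := by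
  have hval (x : H) : resolv T₀ z x = p (L (p.adjoint x)) := by
    rw [hR]
    rfl
  constructor
  · have : (resA T₀ A z).domain = ⊤ := by
      refine (Submodule.eq_top_iff').2 fun x => ⟨trivial, ?_⟩
      change resolv T₀ z x ∈ A.domain
      rw [hval]
      exact hdA _
    rw [this]
    exact dense_univ
  · intro x
    change α (L (p.adjoint x)) = A ⟨resolv T₀ z x, _⟩
    rw [hα]
    congr 1
    exact Subtype.ext (hval x).symm

theorem isBoundedClosure_resB (hB : Dense (B.domain : Set H)) (hBc : B.IsClosed)
    (hdB : ∀ x, p x ∈ B.domain) (hβ : ∀ x, β x = B ⟨p x, hdB x⟩)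
    (hR : resolv T₀ z = p ∘L L ∘L p.adjoint) :
    IsBoundedClosure (resB T₀ B z) (p ∘L L ∘L β.adjoint) := by
  refine ⟨dense_adjoint_domain hBc, fun y => ?_⟩
  change p (L (β.adjoint y)) = resolv T₀ z (B† y)
  rw [hR, ← adjoint_comp_adjoint hB hdB hβ y]
  rfl

theorem isBoundedClosure_preK (hB : Dense (B.domain : Set H)) (hBc : B.IsClosed)
    (hdA : ∀ x, p x ∈ A.domain) (hα : ∀ x, α x = A ⟨p x, hdA x⟩)
    (hdB : ∀ x, p x ∈ B.domain) (hβ : ∀ x, β x = B ⟨p x, hdB x⟩)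
    (hR : resolv T₀ z = p ∘L L ∘L p.adjoint) :
    IsBoundedClosure (preK T₀ A B z) (-(α ∘L L ∘L β.adjoint)) := by
  have hval (y : B†.domain) : resB T₀ B z y = p (L (β.adjoint y)) :=
    ((isBoundedClosure_resB hB hBc hdB hβ hR).2 y).symm
  constructor
  · refine (dense_adjoint_domain hBc).mono fun y hy => ⟨hy, ?_⟩
    exact (congrArg (· ∈ A.domain) (hval ⟨y, hy⟩)).mpr (hdA _)
  · rintro ⟨y, hy, hy'⟩
    change -α (L (β.adjoint y)) = -A ⟨resB T₀ B z ⟨y, hy⟩, _⟩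
    rw [hα]
    congr 2
    exact Subtype.ext (hval ⟨y, hy⟩).symm

end Products

/-! ### The form sum and its resolvent. -/

omit [CompleteSpace H] in
theorem formRep_sumForm {T₀ : H →ₗ.[ℂ] H} {A B : H →ₗ.[ℂ] F} {p : V →L[ℂ] H} {N : V →L[ℂ] V}
    {α β : V →L[ℂ] F} (h : FormRep (formOf T₀) p N)
    (hdA : ∀ x, p x ∈ A.domain) (hα : ∀ x, α x = A ⟨p x, hdA x⟩)
    (hdB : ∀ x, p x ∈ B.domain) (hβ : ∀ x, β x = B ⟨p x, hdB x⟩) {a b : ℝ} (ha : a < 1)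
    (hbα : ∀ x, ‖α x‖ ^ 2 ≤ a * (⟪x, N x⟫_ℂ).re + b * ‖p x‖ ^ 2)
    (hbβ : ∀ x, ‖β x‖ ^ 2 ≤ a * (⟪x, N x⟫_ℂ).re + b * ‖p x‖ ^ 2) :
    FormRep (sumForm T₀ A B) p (N + β.adjoint ∘L α) where
  injective := h.injective
  mem_domain u := by
    refine ⟨fun hu => (h.mem_domain u).1 hu.1, ?_⟩
    rintro ⟨x, rfl⟩
    exact ⟨h.mem x, hdA x, hdB x⟩
  form_eq x y hx hy := by
    change (formOf T₀).form ⟨p x, hx.1⟩ ⟨p y, hy.1⟩ + ⟪B ⟨p x, hdB x⟩, A ⟨p y, hdA y⟩⟫_ℂ =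
      ⟪x, N y + β.adjoint (α y)⟫_ℂ
    rw [h.form_eq, inner_add_right, ContinuousLinearMap.adjoint_inner_right, hα, hβ]
  coercive := by
    obtain ⟨E, κ, hκ, hc⟩ := h.coercive
    -- The perturbation is at most `(‖α x‖² + ‖β x‖²) / 2`, hence at most `a Re ⟪x, N x⟫ + b ‖p
    -- x‖²`; the fraction `1 - a` of the coercivity survives.
    refine ⟨(1 - a) * E + b, (1 - a) * κ, mul_pos (by linarith) hκ, fun x => ?_⟩
    change _ ≤ (⟪x, N x + β.adjoint (α x)⟫_ℂ).re + _
    rw [inner_add_right, ContinuousLinearMap.adjoint_inner_right, Complex.add_re]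
    have h1 : -(‖β x‖ * ‖α x‖) ≤ (⟪β x, α x⟫_ℂ).re :=
      (abs_le.1 ((Complex.abs_re_le_norm _).trans (norm_inner_le_norm _ _))).1
    nlinarith [hbα x, hbβ x, sq_nonneg (‖β x‖ - ‖α x‖),
      mul_le_mul_of_nonneg_left (hc x) (sub_nonneg.2 ha.le)]

theorem isResolventAt_katoR {T₀ : H →ₗ.[ℂ] H} {A B : H →ₗ.[ℂ] F} {p : V →L[ℂ] H} {N : V →L[ℂ] V}
    {α β : V →L[ℂ] F} {L : V →L[ℂ] V} {z : ℂ}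
    (h : FormRep (sumForm T₀ A B) p (N + β.adjoint ∘L α))
    (hq : Dense ((sumForm T₀ A B).domain : Set H))
    (hB : Dense (B.domain : Set H)) (hBc : B.IsClosed)
    (hdA : ∀ x, p x ∈ A.domain) (hα : ∀ x, α x = A ⟨p x, hdA x⟩)
    (hdB : ∀ x, p x ∈ B.domain) (hβ : ∀ x, β x = B ⟨p x, hdB x⟩)
    (h1 : ∀ x, L (repShift p N z x) = x) (h2 : ∀ x, repShift p N z (L x) = x)
    (hR : resolv T₀ z = p ∘L L ∘L p.adjoint)
    (hu : (1 : ℂ) ∈ resolventSet ℂ (opK T₀ A B z)) :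
    IsResolventAt (formSum T₀ A B) z (katoR T₀ A B z) := by
  have hKeq : opK T₀ A B z = -(α ∘L L ∘L β.adjoint) :=
    (isBoundedClosure_preK hB hBc hdA hα hdB hβ hR).bddClosure_eq
  have hunit : IsUnit (1 - opK T₀ A B z) := by
    have := spectrum.mem_resolventSet_iff.1 hu
    rwa [map_one] at this
  have hW1 := Ring.inverse_mul_cancel _ hunit
  have hW2 := Ring.mul_inverse_cancel _ hunit
  set W := Ring.inverse (1 - opK T₀ A B z) with hW
  have hK (y : F) : (1 - opK T₀ A B z) y = y + α (L (β.adjoint y)) := by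
    rw [hKeq, sub_neg_eq_add]
    rfl
  obtain ⟨hL1, hL2⟩ := woodbury (S := repShift p N z) (δ := β.adjoint) (α := α) (W := W) h1 h2
    (fun y => by
      rw [← hK]
      exact congrArg (fun A : F →L[ℂ] F => A y) hW1)
    (fun y => by
      rw [← hK]
      exact congrArg (fun A : F →L[ℂ] F => A y) hW2)
  have hS : repShift p N z + β.adjoint ∘L α = repShift p (N + β.adjoint ∘L α) z := by
    rw [repShift, repShift]
    abel
  rw [hS] at hL1 hL2
  have hres := h.isResolventAt hq hL1 hL2
  have hkR : katoR T₀ A B z =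
      p ∘L (L - L ∘L β.adjoint ∘L W ∘L α ∘L L) ∘L p.adjoint := by
    rw [katoR, hR, (isBoundedClosure_resA hdA hα hR).bddClosure_eq,
      (isBoundedClosure_resB hB hBc hdB hβ hR).bddClosure_eq, ← hW]
    ext x
    change p (L (p.adjoint x)) - p (L (β.adjoint (W (α (L (p.adjoint x)))))) =
      p (L (p.adjoint x) - L (β.adjoint (W (α (L (p.adjoint x))))))
    rw [map_sub]
  rw [hkR]
  exact hres

end KatoFormula

end Kato

end

/-! ### The main theorem. -/

theorem theoremA3 {H F : Type*}
    [NormedAddCommGroup H] [InnerProductSpace ℂ H] [CompleteSpace H]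
    [NormedAddCommGroup F] [InnerProductSpace ℂ F] [CompleteSpace F]
    (T₀ : H →ₗ.[ℂ] H) (γ θ : ℝ) (hT₀ : Kato.IsMSectorial T₀ γ θ)
    (E₀ : ℝ) (hE₀ : -γ < E₀)
    (hsqrt : Kato.sqrtDomain T₀ E₀ = Kato.sqrtDomain T₀† E₀)
    (A B : H →ₗ.[ℂ] F) (hA : A.IsClosed) (hB : B.IsClosed)
    (hdomA : Kato.sqrtDomain T₀ E₀ ≤ A.domain)
    (hdomB : Kato.sqrtDomain T₀ E₀ ≤ B.domain)
    (a b : ℝ) (ha₀ : 0 ≤ a) (ha₁ : a < 1) (hb : 0 ≤ b)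
    (hbdA : ∀ (f : H) (hf : f ∈ Kato.sqrtDomain T₀ E₀) (hq : f ∈ (Kato.formOf T₀).domain),
      ‖A ⟨f, hdomA hf⟩‖ ^ 2 ≤
        a * ((Kato.formOf T₀).form ⟨f, hq⟩ ⟨f, hq⟩).re + b * ‖f‖ ^ 2)
    (hbdB : ∀ (f : H) (hf : f ∈ Kato.sqrtDomain T₀ E₀) (hq : f ∈ (Kato.formOf T₀).domain),
      ‖B ⟨f, hdomB hf⟩‖ ^ 2 ≤
        a * ((Kato.formOf T₀).form ⟨f, hq⟩ ⟨f, hq⟩).re + b * ‖f‖ ^ 2)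
    (hK : Tendsto (fun E : ℝ => ‖Kato.opK T₀ A B (-(E : ℂ))‖) atTop (𝓝 0)) :
    -- Kato's formula is meaningful here
    Kato.KatoAdmissible T₀ A B ∧
    -- the form sum is well defined and m-sectorial, with form domain `dom (T₀^(1/2))`
    (Kato.formOf T₀).domain = Kato.sqrtDomain T₀ E₀ ∧
    (Kato.sumForm T₀ A B).domain = Kato.sqrtDomain T₀ E₀ ∧
    (Kato.sumForm T₀ A B).IsClosedSectorial ∧
    (∃ γ' θ' : ℝ, Kato.IsMSectorial (Kato.formSum T₀ A B) γ' θ') ∧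
    -- the operator defined by Kato's formula exists, is unique, and is the form sum
    ∀ T : H →ₗ.[ℂ] H, Kato.IsKatoSum T₀ A B T ↔ T = Kato.formSum T₀ A B := by

  obtain ⟨V, _, _, _, p, N, h, hlow⟩ := hT₀.exists_formRep
  have hdom := hT₀.formOf_domain_eq hE₀ hsqrt
  have hop := hT₀.formOf_spec.2
  have hdense := hT₀.dense_formOf
  have hmem (x : V) : p x ∈ Kato.sqrtDomain T₀ E₀ := hdom ▸ h.mem x
  have hdA (x : V) : p x ∈ A.domain := hdomA (hmem x)
  have hdB (x : V) : p x ∈ B.domain := hdomB (hmem x)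
  have hbA (x : V) : ‖A ⟨p x, hdA x⟩‖ ^ 2 ≤ a * (⟪x, N x⟫_ℂ).re + b * ‖p x‖ ^ 2 := by
    have := hbdA (p x) (hmem x) (h.mem x)
    rwa [h.form_eq] at this
  have hbB (x : V) : ‖B ⟨p x, hdB x⟩‖ ^ 2 ≤ a * (⟪x, N x⟫_ℂ).re + b * ‖p x‖ ^ 2 := by
    have := hbdB (p x) (hmem x) (h.mem x)
    rwa [h.form_eq] at this
  obtain ⟨α, hα⟩ := Kato.exists_bounded_comp A p N hdA ha₀ hb hbA
  obtain ⟨β, hβ⟩ := Kato.exists_bounded_comp B p N hdB ha₀ hb hbB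
  have hsqd : Dense (Kato.sqrtDomain T₀ E₀ : Set H) := hdom ▸ hdense
  have hAd : Dense (A.domain : Set H) := hsqd.mono hdomA
  have hBd : Dense (B.domain : Set H) := hsqd.mono hdomB
  have hsum := Kato.formRep_sumForm h hdA hα hdB hβ ha₁
    (fun x => by rw [hα]; exact hbA x) (fun x => by rw [hβ]; exact hbB x)
  have hsumdom : (Kato.sumForm T₀ A B).domain = (Kato.formOf T₀).domain := by
    ext u
    rw [hsum.mem_domain, h.mem_domain]
  have hsumd : Dense ((Kato.sumForm T₀ A B).domain : Set H) := hsumdom ▸ hdense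
  have hinv (z : ℂ) (hz : z ∈ Kato.rho T₀) : ∃ L : V →L[ℂ] V,
      (∀ x, L (Kato.repShift p N z x) = x) ∧ (∀ x, Kato.repShift p N z (L x) = x) ∧
        Kato.resolv T₀ z = p ∘L L ∘L p.adjoint := by
    obtain ⟨E, L₀, h1, h2⟩ := h.exists_inverse
    obtain ⟨L, h3, h4⟩ := h.exists_inverse_of_mem_rho hdense (hop.symm ▸ hz) h1 h2
    have hR := h.isResolventAt hdense h3 h4
    rw [hop] at hR
    exact ⟨L, h3, h4, hR.resolv_eq⟩
  have hne : (Kato.katoSet T₀ A B).Nonempty := by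
    -- For large `E` the norm of `K(-E)` is below `1`, and the Neumann series inverts `1 - K(-E)`.
    obtain ⟨E, hE1, hE2⟩ := ((hK.eventually (gt_mem_nhds one_pos)).and
      (eventually_gt_atTop (-γ))).exists
    refine ⟨-(E : ℂ), ⟨_, (hT₀.resolv_spec hE2).1⟩, ?_⟩
    rw [spectrum.mem_resolventSet_iff, map_one]
    exact isUnit_one_sub_of_norm_lt_one hE1
  have hkato : Kato.IsKatoSum T₀ A B (Kato.formSum T₀ A B) := by
    rintro z ⟨hz, hu⟩
    obtain ⟨L, h1, h2, hR⟩ := hinv z hz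
    exact Kato.isResolventAt_katoR hsum hsumd hBd hB hdA hα hdB hβ h1 h2 hR hu
  refine ⟨?_, hdom, hsumdom.trans hdom, hsum.isClosedSectorial, hsum.isMSectorial hsumd,
    fun T => ⟨fun hT => ?_, fun hT => hT ▸ hkato⟩⟩
  · have hres := (hT₀.resolv_spec hE₀).1
    refine
      { dense_T₀ := hT₀.dense_domain
        closed_T₀ := hres.isClosed
        dense_A := hAd
        closed_A := hA
        dense_B := hBd
        closed_B := hB
        dom_A := fun u hu => ?_
        dom_B := fun u hu => ?_
        bounded_K := fun z hz => ?_
        nonempty := hne }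
    · refine hdomA (hdom ▸ (Kato.formOf T₀).operator_domain_le ?_)
      rwa [hop]
    -- The domain of `T₀†` is the range of `p L† p†`, inside the range of `p`.
    · obtain ⟨f, rfl⟩ := (hres.adjoint hT₀.dense_domain).mem_domain_iff.1 hu
      obtain ⟨L, -, -, hR⟩ := hinv _ ⟨_, hres⟩
      rw [hR, ContinuousLinearMap.adjoint_comp, ContinuousLinearMap.adjoint_comp,
        ContinuousLinearMap.adjoint_adjoint]
      exact hdB _
    · obtain ⟨L, -, -, hR⟩ := hinv z hz
      exact ⟨_, Kato.isBoundedClosure_preK hBd hB hdA hα hdB hβ hR⟩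
  · obtain ⟨z, hz⟩ := hne
    exact (hT z hz).operator_unique (hkato z hz)
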